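/- Let $F$ be a field of characteristic $2$ which is a Kaplansky field, i.e. over which there is, up to $F$-algebra isomorphism, exactly one quaternion division algebra (a quaternion algebra over $F$ is a central simple $F$-algebra of dimension $4$). Let $Q$ be the quaternion division algebra over $F$ and $\gamma$ its canonical involution, $\gamma(x)=\mathrm{Trd}_Q(x)-x$. For an $F$-linear involution $\theta$ on $Q$ put $\mathrm{Alt}(Q,\theta)=\{a-\theta(a)\mid a\in Q\}$. A hermitian form over $(Q,\theta)$ is a finite-dimensional right $Q$-vector space $V$ with a bi-additive map $h:V\times V\to Q$ such that $h(xc,yd)=\theta(c)h(x,y)d$ and $h(y,x)=\theta(h(x,y))$; it is nondegenerate if $h(x,y)=0$ for all $y$ implies $x=0$. A quadratic form over $(Q,\theta)$ is a finite-dimensional right $Q$-vector space $V$ with a map $q:V\to Q/\mathrm{Alt}(Q,\theta)$ such that $q(xd)=\theta(d)q(x)d$ for all $x\in V$, $d\in Q$, and $q(x+y)-q(x)-q(y)=h(x,y)+\mathrm{Alt}(Q,\theta)$ for a (necessarily unique) hermitian form $h$ over $(Q,\theta)$, the polar form of $q$. It is nonsingular if $h$ is nondegenerate, totally singular if $h=0$,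 isotropic if $q(x)=0$ for some $x\neq 0$, and anisotropic otherwise. It is of type $(n,m)$ if it is isometric to the orthogonal sum of a nonsingular quadratic form of dimension $n$ and a totally singular one of dimension $m$ (dimensions over $Q$). Then every quadratic form over $(Q,\gamma)$ of type $(4,0)$ or $(3,1)$ is isotropic. Moreover $\widetilde u(Q)=3$, that is, for every $F$-linear involution $\theta$ on $Q$ the supremum of the dimensions of the anisotropic nonsingular quadratic forms over $(Q,\theta)$ is $3$. -/

import Mathlib

open scoped RightActions

universe u v w

/-- A quaternion algebra over a field `F`: a central simple `F`-algebra of degree `2`, i.e. of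
dimension `2 ^ 2` over `F`. -/
structure IsQuaternionAlgebra (F : Type u) (A : Type v) [Field F] [Ring A] [Algebra F A] :
    Prop where
  central : Algebra.IsCentral F A
  simple : IsSimpleRing A
  finrank_eq : Module.finrank F A = 4

/-- A Kaplansky field: a field over which there is, up to isomorphism of algebras, exactly one
quaternion division algebra. -/
def IsKaplanskyField (F : Type u) [Field F] : Prop :=
  ∃ (Q : Type u) (_ : DivisionRing Q) (_ : Algebra F Q), IsQuaternionAlgebra F Q ∧
    ∀ (Q' : Type u) [DivisionRing Q'] [Algebra F Q'], IsQuaternionAlgebra F Q' →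
      Nonempty (Q' ≃ₐ[F] Q)

/-- An `F`-linear involution on an `F`-algebra `A`. -/
structure FInvolution (F : Type u) (A : Type v) [Field F] [Ring A] [Algebra F A] where
  toLinearMap : A →ₗ[F] A
  map_mul' : ∀ x y : A, toLinearMap (x * y) = toLinearMap y * toLinearMap x
  invol' : ∀ x : A, toLinearMap (toLinearMap x) = x

namespace FInvolution

variable {F : Type u} {A : Type v} [Field F] [Ring A] [Algebra F A]

instance : CoeFun (FInvolution F A) (fun _ => A → A) := ⟨fun θ => θ.toLinearMap⟩

/-- `Alt(A, θ) = {a - θ(a) | a ∈ A}`. -/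
def alt (θ : FInvolution F A) : Submodule F A :=
  LinearMap.range (LinearMap.id - θ.toLinearMap)

/-- The canonical involution `γ` of a quaternion algebra is characterised by the condition that
every `x` is a root of the polynomial `(X - x)(X - γ(x)) = X² - (x + γ(x)) X + γ(x) x` with
coefficients in the base field; these coefficients are the reduced trace (up to sign) and the
reduced norm of `x`, and `γ(x) = Trd(x) - x`. -/
def IsCanonical (γ : FInvolution F A) : Prop :=
  ∀ x : A, ∃ t n : F, x + γ x = algebraMap F A t ∧ γ x * x = algebraMap F A n

theorem conj_mem (θ : FInvolution F A) (d : A) : θ.alt ≤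
    θ.alt.comap ((LinearMap.mulLeft F (θ d)).comp (LinearMap.mulRight F d)) := by
  rintro _ ⟨a, rfl⟩
  refine ⟨θ d * (a * d), ?_⟩
  simp [θ.map_mul', θ.invol', mul_sub, sub_mul, mul_assoc]

/-- The map `A / Alt(A, θ) → A / Alt(A, θ)` induced by `a ↦ θ(d) a d`. -/
def conj (θ : FInvolution F A) (d : A) : (A ⧸ θ.alt) →ₗ[F] (A ⧸ θ.alt) :=
  θ.alt.mapQ θ.alt ((LinearMap.mulLeft F (θ d)).comp (LinearMap.mulRight F d)) (θ.conj_mem d)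

end FInvolution

section Forms

variable {F : Type u} {D : Type v} [Field F] [DivisionRing D] [Algebra F D]

/-- A hermitian form over `(D, θ)` on the right `D`-vector space `V`. -/
structure HermForm (θ : FInvolution F D) (V : Type w) [AddCommGroup V] [Module Dᵐᵒᵖ V] where
  toFun : V → V → D
  add_left' : ∀ x y z, toFun (x + y) z = toFun x z + toFun y z
  add_right' : ∀ x y z, toFun x (y + z) = toFun x y + toFun x z
  smul' : ∀ (x y : V) (c d : D), toFun (x <• c) (y <• d) = θ c * toFun x y * d
  symm' : ∀ x y, toFun y x = θ (toFun x y)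

namespace HermForm

variable {θ : FInvolution F D} {V : Type w} [AddCommGroup V] [Module Dᵐᵒᵖ V]

instance : CoeFun (HermForm θ V) (fun _ => V → V → D) := ⟨toFun⟩

def Nondegenerate (h : HermForm θ V) : Prop :=
  ∀ x, (∀ y, h x y = 0) → x = 0

end HermForm

/-- A quadratic form over `(D, θ)` on the right `D`-vector space `V`. -/
structure QuadForm (θ : FInvolution F D) (V : Type w) [AddCommGroup V] [Module Dᵐᵒᵖ V] where
  toFun : V → D ⧸ θ.alt
  smul' : ∀ (x : V) (d : D), toFun (x <• d) = θ.conj d (toFun x)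
  exists_polar' : ∃ h : HermForm θ V, ∀ x y,
    toFun (x + y) - toFun x - toFun y = θ.alt.mkQ (h x y)

namespace QuadForm

variable {θ : FInvolution F D} {V : Type w} [AddCommGroup V] [Module Dᵐᵒᵖ V]
  {W : Type w} [AddCommGroup W] [Module Dᵐᵒᵖ W]

instance : CoeFun (QuadForm θ V) (fun _ => V → D ⧸ θ.alt) := ⟨toFun⟩

/-- The polar form of a quadratic form; it is unique by `polar_unique`. -/
noncomputable def polar (q : QuadForm θ V) : HermForm θ V := q.exists_polar'.choose

theorem polar_spec (q : QuadForm θ V) (x y : V) :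
    q (x + y) - q x - q y = θ.alt.mkQ (q.polar x y) := q.exists_polar'.choose_spec x y

theorem polar_unique (q : QuadForm θ V) (h : HermForm θ V)
    (hh : ∀ x y, q (x + y) - q x - q y = θ.alt.mkQ (h x y)) (x y : V) : h x y = q.polar x y := by
  have key : ∀ y, h x y - q.polar x y ∈ θ.alt := fun y => by
    rw [← Submodule.ker_mkQ θ.alt, LinearMap.mem_ker, map_sub, ← hh, ← polar_spec, sub_self]
  by_contra hne
  set c := h x y - q.polar x y with hc
  have hc0 : c ≠ 0 := sub_ne_zero.mpr hne
  have h1 : θ 1 = 1 := by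
    have := θ.map_mul' 1 (θ 1)
    rwa [one_mul, θ.invol', one_mul, eq_comm] at this
  have all : ∀ a : D, a ∈ θ.alt := fun a => by
    have e : ∀ g : HermForm θ V, g x (y <• (c⁻¹ * a)) = g x y * (c⁻¹ * a) := fun g => by
      have := g.smul' x y 1 (c⁻¹ * a)
      simpa [h1] using this
    have := key (y <• (c⁻¹ * a))
    rwa [e, e, ← sub_mul, ← hc, mul_inv_cancel_left₀ hc0] at this
  have neg : ∀ a : D, θ a = -a := fun a => by
    obtain ⟨b, rfl⟩ := all a
    simp [θ.invol']
  obtain ⟨a, ha⟩ := all 1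
  have h2 : (1 : D) + 1 = 0 := by
    have := neg 1
    rw [h1] at this
    nth_rewrite 2 [this]
    exact add_neg_cancel 1
  have h3 : a + a = 1 := by simpa [neg] using ha
  have h4 : a + a = (1 + 1) * a := by rw [add_mul, one_mul]
  rw [h4, h2, zero_mul] at h3
  exact zero_ne_one h3

/-- `q` represents `0`. -/
def Isotropic (q : QuadForm θ V) : Prop := ∃ x : V, x ≠ 0 ∧ q x = 0

def Nonsingular (q : QuadForm θ V) : Prop := q.polar.Nondegenerate

def TotallySingular (q : QuadForm θ V) : Prop := ∀ x y, q.polar x y = 0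

def Isometric (q₁ : QuadForm θ V) (q₂ : QuadForm θ W) : Prop :=
  ∃ e : V ≃ₗ[Dᵐᵒᵖ] W, ∀ x, q₁ x = q₂ (e x)

/-- The orthogonal sum of two quadratic forms. -/
def orthSum (q₁ : QuadForm θ V) (q₂ : QuadForm θ W) : QuadForm θ (V × W) where
  toFun x := q₁ x.1 + q₂ x.2
  smul' x d := by simp [q₁.smul', q₂.smul']
  exists_polar' := by
    refine ⟨⟨fun x y => q₁.polar x.1 y.1 + q₂.polar x.2 y.2, ?_, ?_, ?_, ?_⟩, ?_⟩
    · intro x y z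
      simp only [Prod.fst_add, Prod.snd_add, HermForm.add_left']
      abel
    · intro x y z
      simp only [Prod.fst_add, Prod.snd_add, HermForm.add_right']
      abel
    · intro x y c d
      simp only [Prod.smul_fst, Prod.smul_snd, HermForm.smul', mul_add, add_mul]
    · intro x y
      simp only [map_add]
      rw [q₁.polar.symm', q₂.polar.symm']
    · intro x y
      simp only [Prod.fst_add, Prod.snd_add, map_add, ← polar_spec]
      abel

/-- `q` is of type `(n, m)`: it is isometric to the orthogonal sum of a nonsingular form of
dimension `n` and a totally singular form of dimension `m`. -/
def HasType (q : QuadForm θ V) (n m : ℕ) : Prop :=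
  ∃ (V₁ V₂ : Type w) (_ : AddCommGroup V₁) (_ : AddCommGroup V₂)
    (_ : Module Dᵐᵒᵖ V₁) (_ : Module Dᵐᵒᵖ V₂)
    (_ : Module.Finite Dᵐᵒᵖ V₁) (_ : Module.Finite Dᵐᵒᵖ V₂)
    (q₁ : QuadForm θ V₁) (q₂ : QuadForm θ V₂),
    q₁.Nonsingular ∧ Module.finrank Dᵐᵒᵖ V₁ = n ∧
    q₂.TotallySingular ∧ Module.finrank Dᵐᵒᵖ V₂ = m ∧
    q.Isometric (q₁.orthSum q₂)

end QuadForm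
/-- The supremum of the dimensions of the anisotropic nonsingular quadratic forms over `(D, θ)`.
(Every finite-dimensional right `D`-vector space has an isomorphic copy in the universe of `D`.) -/
noncomputable def uTilde (θ : FInvolution F D) : ℕ∞ :=
  sSup {n : ℕ∞ | ∃ (V : Type v) (_ : AddCommGroup V) (_ : Module Dᵐᵒᵖ V)
    (_ : Module.Finite Dᵐᵒᵖ V) (q : QuadForm θ V),
    q.Nonsingular ∧ ¬ q.Isotropic ∧ n = (Module.finrank Dᵐᵒᵖ V : ℕ∞)}

end Forms

/-! Since `Alt(Q, γ) = F`, quadratic forms over `(Q, γ)` take values modulo `F`. A nonsingular form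
has an orthogonal basis whose values `aᵢ` have nonzero reduced trace, and any nontrivial sum `∑
γ(dᵢ) aᵢ dᵢ` lying in `F` yields an isotropic vector. Dividing `aᵢ` by its trace gives a root of `X²
+ X + δᵢ`; what matters is `δᵢ` modulo the radical, the elements `δ` with `[δ, c)` split for all
`c`.

Uniqueness of `Q` makes the symbol a pairing with two values, and every nonsplit symbol is realized
by generators of `Q`. Modulo `F`, the form of `aᵢ` represents all multiples of any trace-one element
with invariant `δᵢ` (`IsArtinSchreier.exists_value`). If several `[δᵢ, c)` are nonsplit for one `c`,
such elements can be chosen in the plane spanned by `i` and `j` modulo `F`. Three vectors in that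
plane are dependent, so three values suffice when `δ₁ + δ₂ + δ₃` is not radical
(`exists_value_three`). For four values an auxiliary invariant `b` links a slot `c` for `δ₁, δ₂` to
a slot `c'` for `δ₃, δ₄` (`exists_value_four`). In type `(3, 1)` the singular part is used to move
`δ₁` until the sum is not radical (`exists_value_three_one`).

Conversely, invariants `a, b, a + b` outside the radical give an anisotropic form of dimension three
(`exists_anisotropic_three`). Any other involution is `γ` followed by an inner automorphism, and
scaling carries its forms to forms over `γ`. -/

section Symbol

/-! ### Splitting of the symbol `[a, c)`. -/

variable {F : Type u} [Field F] [CharP F 2]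

/-- The quaternion algebra `[a, c)` of a field of characteristic two is split, expressed through
its Artin–Schreier slot `a`. -/
def SymbolSplits (a c : F) : Prop := ∃ x y : F, a = c * x ^ 2 + (y ^ 2 + y)

/-- The quaternion algebra `[a, c)` is split for every nonzero `c`. -/
def SymbolRadical (a : F) : Prop := ∀ c : F, c ≠ 0 → SymbolSplits a c

theorem SymbolSplits.add {a b c : F} (ha : SymbolSplits a c) (hb : SymbolSplits b c) :
    SymbolSplits (a + b) c := by
  obtain ⟨x, y, rfl⟩ := ha
  obtain ⟨z, w, rfl⟩ := hb
  refine ⟨x + z, y + w, ?_⟩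
  rw [CharTwo.add_sq, CharTwo.add_sq]
  ring

/-- The definition is additive in `a`; the norm condition, for the algebra `F[X]/(X² + X + a)`, is
multiplicative in `c`. Inverting one variable passes between them. -/
theorem symbolSplits_iff_norm {a c : F} (hc : c ≠ 0) :
    SymbolSplits a c ↔ ∃ x y : F, c = x ^ 2 + x * y + a * y ^ 2 := by
  have h2 : (2 : F) = 0 := CharTwo.two_eq_zero
  constructor
  · rintro ⟨x, y, h⟩
    by_cases hx : x = 0
    · subst hx
      refine ⟨c + y * (1 + c), 1 + c, ?_⟩
      rw [h]
      grind
    · refine ⟨y / x, 1 / x, ?_⟩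
      rw [h]
      field_simp
      grind
  · rintro ⟨x, y, h⟩
    by_cases hy : y = 0
    · subst hy
      have hx : x ≠ 0 := by rintro rfl; simp at h; exact hc h
      refine ⟨a / x, a, ?_⟩
      rw [h]
      field_simp
      grind
    · refine ⟨1 / y, x / y, ?_⟩
      rw [h]
      field_simp
      grind

theorem SymbolSplits.mul {a c d : F} (hc : c ≠ 0) (hd : d ≠ 0) (h : SymbolSplits a c)
    (h' : SymbolSplits a d) : SymbolSplits a (c * d) := by
  have h2 : (2 : F) = 0 := CharTwo.two_eq_zero
  rw [symbolSplits_iff_norm hc] at h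
  rw [symbolSplits_iff_norm hd] at h'
  rw [symbolSplits_iff_norm (mul_ne_zero hc hd)]
  obtain ⟨x, y, rfl⟩ := h
  obtain ⟨z, w, rfl⟩ := h'
  exact ⟨x * z + a * y * w, x * w + y * z + y * w, by grind⟩

theorem symbolSplits_mul_self (a : F) {c : F} (hc : c ≠ 0) : SymbolSplits a (c * c) :=
  (symbolSplits_iff_norm (mul_ne_zero hc hc)).2 ⟨c, 0, by ring⟩

theorem SymbolSplits.of_mul {a c d : F} (hc : c ≠ 0) (hd : d ≠ 0) (h : SymbolSplits a c)
    (h' : SymbolSplits a (c * d)) : SymbolSplits a d := by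
  have h1 := h.mul hc (mul_ne_zero hc hd) h'
  have h2 := h1.mul (mul_ne_zero hc (mul_ne_zero hc hd))
    (mul_self_ne_zero.2 (inv_ne_zero hc)) (symbolSplits_mul_self a (inv_ne_zero hc))
  convert h2 using 1
  field_simp

theorem SymbolSplits.of_add_left {a b c : F} (h : SymbolSplits (a + b) c)
    (ha : SymbolSplits a c) : SymbolSplits b c := by
  simpa [← add_assoc, CharTwo.add_self_eq_zero] using ha.add h

theorem SymbolRadical.add {a b : F} (ha : SymbolRadical a) (hb : SymbolRadical b) :
    SymbolRadical (a + b) := fun c hc => (ha c hc).add (hb c hc)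

theorem SymbolRadical.of_add_left {a b : F} (h : SymbolRadical (a + b)) (ha : SymbolRadical a) :
    SymbolRadical b := fun c hc => (h c hc).of_add_left (ha c hc)

/-- The symbol `[a, c)` takes at most two values in each of its slots. -/
structure SymbolBimultiplicative (F : Type u) [Field F] : Prop where
  add : ∀ a b c : F, c ≠ 0 → ¬SymbolSplits a c → ¬SymbolSplits b c → SymbolSplits (a + b) c
  mul : ∀ a c d : F, c ≠ 0 → d ≠ 0 → ¬SymbolSplits a c → ¬SymbolSplits a d →
    SymbolSplits a (c * d)

namespace SymbolBimultiplicative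

theorem _root_.SymbolSplits.not_mul {a c d : F} (hc : c ≠ 0) (hd : d ≠ 0)
    (h : ¬SymbolSplits a c) (h' : SymbolSplits a d) : ¬SymbolSplits a (c * d) := fun h1 => by
  rw [mul_comm] at h1
  exact h (h'.of_mul hd hc h1)

/-- The `c` that split `[a, c)` form a subgroup of `Fˣ`, and a group is not a union of two proper
subgroups. -/
theorem _root_.exists_not_splits_two {a b : F} (ha : ¬SymbolRadical a) (hb : ¬SymbolRadical b) :
    ∃ c : F, c ≠ 0 ∧ ¬SymbolSplits a c ∧ ¬SymbolSplits b c := by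
  simp only [SymbolRadical, not_forall] at ha hb
  obtain ⟨c, hc, hac⟩ := ha
  obtain ⟨d, hd, hbd⟩ := hb
  by_cases hbc : SymbolSplits b c
  · by_cases had : SymbolSplits a d
    · exact ⟨c * d, mul_ne_zero hc hd, SymbolSplits.not_mul hc hd hac had,
        fun h => hbd (hbc.of_mul hc hd h)⟩
    · exact ⟨d, hd, had, hbd⟩
  · exact ⟨c, hc, hac, hbc⟩

/-- Three nontrivial characters with values `±1` take the value `-1` simultaneously unless their
product is trivial. -/
theorem exists_not_splits_three (H : SymbolBimultiplicative F)
    {a b d : F} (ha : ¬SymbolRadical a) (hb : ¬SymbolRadical b) (hd : ¬SymbolRadical d)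
    (habd : ¬SymbolRadical (a + b + d)) :
    ∃ c : F, c ≠ 0 ∧ ¬SymbolSplits a c ∧ ¬SymbolSplits b c ∧ ¬SymbolSplits d c := by
  obtain ⟨p, hp, hpa, hpb⟩ := exists_not_splits_two ha hb
  obtain ⟨q, hq, hqa, hqd⟩ := exists_not_splits_two ha hd
  obtain ⟨r, hr, hrb, hrd⟩ := exists_not_splits_two hb hd
  by_cases hpd : SymbolSplits d p
  swap
  · exact ⟨p, hp, hpa, hpb, hpd⟩
  by_cases hqb : SymbolSplits b q
  swap
  · exact ⟨q, hq, hqa, hqb, hqd⟩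
  by_cases hra : SymbolSplits a r
  swap
  · exact ⟨r, hr, hra, hrb, hrd⟩
  simp only [SymbolRadical, not_forall] at habd
  obtain ⟨s, hs, hsum⟩ := habd
  -- An odd number of the three symbols is nonsplit at `s`. If only one is, multiplying `s` by the
  -- witness for the other two makes all three nonsplit.
  by_cases hsa : SymbolSplits a s <;> by_cases hsb : SymbolSplits b s <;>
    by_cases hsd : SymbolSplits d s
  · exact absurd ((hsa.add hsb).add hsd) hsum
  · refine ⟨p * s, mul_ne_zero hp hs, SymbolSplits.not_mul hp hs hpa hsa,
      SymbolSplits.not_mul hp hs hpb hsb, fun h => hsd (hpd.of_mul hp hs h)⟩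
  · refine ⟨q * s, mul_ne_zero hq hs, SymbolSplits.not_mul hq hs hqa hsa,
      fun h => hsb (hqb.of_mul hq hs h), SymbolSplits.not_mul hq hs hqd hsd⟩
  · exact absurd ((add_assoc a b d) ▸ hsa.add (H.add _ _ _ hs hsb hsd)) hsum
  · refine ⟨r * s, mul_ne_zero hr hs, fun h => hsa (hra.of_mul hr hs h),
      SymbolSplits.not_mul hr hs hrb hsb, SymbolSplits.not_mul hr hs hrd hsd⟩
  · refine absurd ?_ hsum
    rw [add_right_comm]
    exact (H.add _ _ _ hs hsa hsd).add hsb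
  · exact absurd ((H.add _ _ _ hs hsa hsb).add hsd) hsum
  · exact ⟨s, hs, hsa, hsb, hsd⟩

end SymbolBimultiplicative

end Symbol

/-! ### The canonical involution and conjugacy of quadratic elements. -/

section Canonical

variable {F : Type u} [Field F] {Q : Type v} [DivisionRing Q] [Algebra F Q]

theorem FInvolution.map_one (θ : FInvolution F Q) : θ 1 = 1 := by
  have := θ.map_mul' 1 (θ 1)
  rwa [one_mul, θ.invol', one_mul, eq_comm] at this

theorem FInvolution.map_smul_one (θ : FInvolution F Q) (r : F) : θ (r • 1) = r • 1 := by
  rw [map_smul, θ.map_one]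

theorem FInvolution.map_ne_zero (θ : FInvolution F Q) {x : Q} (hx : x ≠ 0) : θ x ≠ 0 := by
  intro h
  have := θ.invol' x
  rw [h, map_zero] at this
  exact hx this.symm

theorem smul_one_injective {r s : F} (h : r • (1 : Q) = s • 1) : r = s := by
  simpa [← Algebra.algebraMap_eq_smul_one] using h

theorem charP_two_of_algebra (F : Type u) (Q : Type v) [Field F] [DivisionRing Q] [Algebra F Q]
    [CharP F 2] : CharP Q 2 :=
  charP_of_injective_algebraMap (algebraMap F Q).injective 2

theorem ne_smul_one_of_not_commute {x y : Q} (h : x * y ≠ y * x) (r : F) : x ≠ r • 1 := by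
  rintro rfl
  simp at h

variable [CharP F 2] {γ : FInvolution F Q}

theorem FInvolution.IsCanonical.exists_trace_norm (hγ : γ.IsCanonical) (x : Q) :
    ∃ t n : F, γ x = x + t • 1 ∧ γ x * x = n • 1 ∧ x * x = t • x + n • 1 := by
  have := charP_two_of_algebra F Q
  obtain ⟨t, n, ht, hn⟩ := hγ x
  rw [Algebra.algebraMap_eq_smul_one] at ht hn
  have h1 : γ x = x + t • 1 := by
    rw [← ht, CharTwo.add_cancel_left]
  refine ⟨t, n, h1, hn, ?_⟩
  rw [← hn, h1, add_mul, smul_one_mul, add_comm (x * x), CharTwo.add_cancel_left]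

theorem FInvolution.IsCanonical.exists_norm (hγ : γ.IsCanonical) {x : Q} (hx : x ≠ 0) :
    ∃ n : F, n ≠ 0 ∧ γ x * x = n • 1 := by
  obtain ⟨t, n, -, hn, -⟩ := hγ.exists_trace_norm x
  refine ⟨n, ?_, hn⟩
  rintro rfl
  rw [zero_smul] at hn
  exact mul_ne_zero (γ.map_ne_zero hx) hx hn

/-- An element outside `F` satisfies only one monic quadratic equation, so its trace can be read off
from any such equation. -/
theorem FInvolution.IsCanonical.apply_eq_add_of_sq (hγ : γ.IsCanonical) {x : Q} {t n : F}
    (hx : ∀ r : F, x ≠ r • 1) (h : x * x = t • x + n • 1) : γ x = x + t • 1 := by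
  obtain ⟨t', n', h1, -, h3⟩ := hγ.exists_trace_norm x
  suffices t' = t by rw [h1, this]
  by_contra hne
  have h4 : (t' - t) • x = (n - n') • 1 := by
    rw [sub_smul, sub_smul]
    linear_combination (norm := module) h - h3
  refine hx ((t' - t)⁻¹ * (n - n')) ?_
  rw [mul_smul, ← h4, smul_smul, inv_mul_cancel₀ (sub_ne_zero.2 hne), one_smul]

/-- Elements with the same separable or inseparable quadratic equation are conjugate. -/
theorem exists_conj_of_sq {x y : Q} {t n : F} (hx : x * x = t • x + n • 1)
    (hy : y * y = t • y + n • 1) (hc : ∃ m, x * m ≠ m * x) :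
    ∃ g : Q, g ≠ 0 ∧ y * g = g * x := by
  have := charP_two_of_algebra F Q
  -- As `x + t` is the conjugate of `x`, the map `m ↦ y m + m (x + t)` produces intertwiners of `x`
  -- and `y`. It does not vanish at `1` unless `y = x + t`, and then any `m` not commuting with `x`
  -- serves.
  have key : ∀ m : Q, y * (y * m + m * x + t • m) = (y * m + m * x + t • m) * x := by
    intro m
    simp only [mul_add, add_mul, mul_assoc, hx, mul_smul_comm, smul_mul_assoc, mul_one]
    rw [← mul_assoc, hy]
    simp only [add_mul, smul_mul_assoc, one_mul]
    have h2 : (2 : F) = 0 := CharTwo.two_eq_zero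
    linear_combination (norm := skip) h2 • (t • (y * m)) - h2 • (t • (m * x))
    match_scalars <;> ring
  by_cases h1 : y * 1 + 1 * x + t • 1 = 0
  · obtain ⟨m, hm⟩ := hc
    refine ⟨y * m + m * x + t • m, ?_, key m⟩
    intro h0
    apply hm
    rw [mul_one, one_mul, add_assoc, CharTwo.add_eq_zero] at h1
    rw [h1, add_mul, smul_mul_assoc, one_mul, add_right_comm, add_assoc (x * m),
      CharTwo.add_self_eq_zero, add_zero, CharTwo.add_eq_zero] at h0
    exact h0
  · exact ⟨_, h1, key 1⟩

end Canonical

/-- Standard generators of the quaternion algebra `[a, c)` of characteristic two. -/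
structure IsSymbolPair {F : Type u} {Q : Type v} [Field F] [DivisionRing Q] [Algebra F Q]
    (a c : F) (i j : Q) : Prop where
  ii : i * i = i + a • 1
  ji : j * i = i * j + j
  jj : j * j = c • 1
  ne : j ≠ 0

/-! ### Standard generators inside a quaternion algebra. -/

section Pair

variable {F : Type u} [Field F] {Q : Type v} [DivisionRing Q] [Algebra F Q]
  {γ : FInvolution F Q}

namespace IsSymbolPair

variable {a c : F} {i j : Q}

theorem ii_mul (P : IsSymbolPair a c i j) (x : Q) : i * (i * x) = i * x + a • x := by
  rw [← mul_assoc, P.ii, add_mul, smul_one_mul]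

theorem ji_mul (P : IsSymbolPair a c i j) (x : Q) : j * (i * x) = i * (j * x) + j * x := by
  rw [← mul_assoc, P.ji, add_mul, mul_assoc]

theorem ne_zero (P : IsSymbolPair a c i j) : c ≠ 0 := by
  rintro rfl
  have := P.jj
  rw [zero_smul, mul_self_eq_zero] at this
  exact P.ne this

theorem not_commute (P : IsSymbolPair a c i j) : i * j ≠ j * i := by
  rw [P.ji]
  simpa using P.ne

theorem conj (P : IsSymbolPair a c i j) {g : Q} (hg : g ≠ 0) :
    IsSymbolPair a c (g⁻¹ * i * g) (g⁻¹ * j * g) := by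
  have key : ∀ x y : Q, (g⁻¹ * x * g) * (g⁻¹ * y * g) = g⁻¹ * (x * y) * g := fun x y => by
    simp only [mul_assoc, mul_inv_cancel_left₀ hg]
  refine ⟨?_, ?_, ?_, ?_⟩
  · rw [key, P.ii, mul_add, add_mul, mul_smul_comm, smul_mul_assoc, mul_one, inv_mul_cancel₀ hg]
  · rw [key, key, P.ji, mul_add, add_mul]
  · rw [key, P.jj, mul_smul_comm, smul_mul_assoc, mul_one, inv_mul_cancel₀ hg]
  · exact mul_ne_zero (mul_ne_zero (inv_ne_zero hg) P.ne) hg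

variable [CharP F 2]

theorem map_left (P : IsSymbolPair a c i j) (hγ : γ.IsCanonical) : γ i = i + 1 := by
  have := hγ.apply_eq_add_of_sq (t := 1) (n := a) (ne_smul_one_of_not_commute P.not_commute)
    (by rw [P.ii, one_smul])
  rwa [one_smul] at this

theorem map_right (P : IsSymbolPair a c i j) (hγ : γ.IsCanonical) : γ j = j := by
  have := hγ.apply_eq_add_of_sq (t := 0) (n := c) (ne_smul_one_of_not_commute P.not_commute.symm)
    (by rw [P.jj, zero_smul, zero_add])
  rwa [zero_smul, add_zero] at this

/-- If `c` were the norm of `x + y i`, then `x + y i + j` would have norm zero, hence vanish, and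
`j` would commute with `i`. -/
theorem not_splits (P : IsSymbolPair a c i j) (hγ : γ.IsCanonical) : ¬SymbolSplits a c := by
  have h2 : (2 : F) = 0 := CharTwo.two_eq_zero
  rw [symbolSplits_iff_norm P.ne_zero]
  rintro ⟨x, y, h⟩
  have h0 : (x • 1 + y • i + j) * γ (x • 1 + y • i + j) = 0 := by
    simp only [map_add, map_smul, γ.map_one, P.map_left hγ, P.map_right hγ]
    simp only [mul_add, add_mul, smul_mul_assoc, mul_smul_comm, one_mul, mul_one, P.ii, P.ji, P.jj,
      smul_add, h]
    match_scalars <;> grind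
  have h1 : x • 1 + y • i + j = 0 := by
    by_contra hne
    exact mul_ne_zero hne (γ.map_ne_zero hne) h0
  apply P.not_commute
  have := charP_two_of_algebra F Q
  rw [CharTwo.add_eq_zero] at h1
  rw [← h1]
  simp [mul_add, add_mul]

end IsSymbolPair

variable [CharP F 2]

/-- The coordinates are reduced traces: `q = Trd(e)` and `p = Trd((e + q i) i)`. -/
theorem FInvolution.IsCanonical.exists_smul_add_of_commute (hγ : γ.IsCanonical) {i e : Q}
    (hi : γ i = i + 1) (he : e * i = i * e) : ∃ p q : F, e = p • 1 + q • i := by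
  have h2 : (2 : F) = 0 := CharTwo.two_eq_zero
  obtain ⟨t, n, ht, -, -⟩ := hγ.exists_trace_norm e
  obtain ⟨p, n', hp, -, -⟩ := hγ.exists_trace_norm ((e + t • i) * i)
  refine ⟨p, t, ?_⟩
  rw [γ.map_mul', map_add, map_smul, hi, ht, add_mul, mul_add] at hp
  simp only [mul_add, add_mul, smul_mul_assoc, mul_smul_comm, one_mul, mul_one, he, smul_add] at hp
  linear_combination (norm := skip) hp - h2 • (t • i)
  match_scalars <;> grind

/-- Since `i` and `i + 1` satisfy the same equation, some `j` conjugates one into the other.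
Comparing this relation with its image under `γ` shows that `j` has trace zero, so `j² ∈ F`. -/
theorem exists_symbolPair_of_map (hγ : γ.IsCanonical) [Algebra.IsCentral F Q] {i : Q} {a : F}
    (hi : γ i = i + 1) (hii : i * i = i + a • 1) : ∃ (c : F) (j : Q), IsSymbolPair a c i j := by
  have h2 : (2 : F) = 0 := CharTwo.two_eq_zero
  have hnc : ∃ m, i * m ≠ m * i := by
    by_contra! hc
    have hi' : i ∈ Subalgebra.center F Q := Subalgebra.mem_center_iff.2 fun b => (hc b).symm
    rw [Algebra.IsCentral.center_eq_bot, Algebra.mem_bot] at hi'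
    obtain ⟨r, rfl⟩ := hi'
    rw [Algebra.algebraMap_eq_smul_one, γ.map_smul_one] at hi
    simp at hi
  obtain ⟨j, hj0, hj⟩ := exists_conj_of_sq (x := i) (y := i + 1) (t := 1) (n := a)
    (by rw [hii, one_smul]) (by
      simp only [mul_add, add_mul, hii, one_mul, mul_one]
      match_scalars <;> grind) hnc
  rw [add_mul, one_mul] at hj
  obtain ⟨t, c, h1, -, h3⟩ := hγ.exists_trace_norm j
  have ht : t = 0 := by
    have h := congrArg γ hj
    rw [map_add, γ.map_mul', γ.map_mul', hi, h1] at h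
    simp only [mul_add, add_mul, one_mul, mul_one, smul_mul_assoc, mul_smul_comm] at h
    have h5 : t • (1 : Q) = 0 := by
      linear_combination (norm := skip) h - hj - h2 • j
      match_scalars <;> grind
    simpa using h5
  exact ⟨c, j, hii, hj.symm, by rw [h3, ht, zero_smul, zero_add], hj0⟩

end Pair

/-! ### Nonsplit symbols are realized in `Q`. -/

section Kaplansky

open scoped Quaternion

variable {F : Type u} [Field F]

section
variable [CharP F 2]

/-- The reduced norm is `N ⊥ cN` with `N = X² + XY + aY²`. A nontrivial zero makes `c` a quotient of
norms or makes `N` isotropic; either would split the symbol. -/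
theorem QuaternionAlgebra.isUnit_or_eq_zero_of_not_splits {a c : F} (hc : c ≠ 0)
    (h : ¬SymbolSplits a c) (x : ℍ[F,a,1,c]) : IsUnit x ∨ x = 0 := by
  have h2 : (2 : F) = 0 := CharTwo.two_eq_zero
  obtain ⟨p, q, r, s⟩ := x
  set n : F := p ^ 2 + p * q + a * q ^ 2 + c * (r ^ 2 + r * s + a * s ^ 2) with hn
  by_cases hn0 : n = 0
  · right
    have hw : SymbolSplits a c ∨ r ^ 2 + r * s + a * s ^ 2 = 0 := by
      by_cases hw : r ^ 2 + r * s + a * s ^ 2 = 0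
      · exact Or.inr hw
      · left
        have h1 : SymbolSplits a (r ^ 2 + r * s + a * s ^ 2) :=
          (symbolSplits_iff_norm hw).2 ⟨_, _, rfl⟩
        have e : (r ^ 2 + r * s + a * s ^ 2) * c = p ^ 2 + p * q + a * q ^ 2 := by grind
        exact h1.of_mul hw hc ((symbolSplits_iff_norm (mul_ne_zero hw hc)).2 ⟨p, q, e⟩)
    have h0 : r ^ 2 + r * s + a * s ^ 2 = 0 := hw.resolve_left h
    have h0' : p ^ 2 + p * q + a * q ^ 2 = 0 := by rw [h0] at hn; grind
    have aux : ∀ y z : F, y ^ 2 + y * z + a * z ^ 2 = 0 → y = 0 ∧ z = 0 := by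
      intro y z hyz
      by_cases hz : z = 0
      · subst hz
        simpa using hyz
      · exact absurd ⟨0, y / z, by field_simp; grind⟩ h
    obtain ⟨rfl, rfl⟩ := aux _ _ h0
    obtain ⟨rfl, rfl⟩ := aux _ _ h0'
    rfl
  · left
    have e1 : (⟨p, q, r, s⟩ : ℍ[F,a,1,c]) * ⟨p + q, q, r, s⟩ = n • 1 := by
      ext <;> simp <;> grind
    have e2 : (⟨p + q, q, r, s⟩ : ℍ[F,a,1,c]) * ⟨p, q, r, s⟩ = n • 1 := by
      ext <;> simp <;> grind
    refine isUnit_iff_exists.2 ⟨n⁻¹ • ⟨p + q, q, r, s⟩, ?_, ?_⟩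
    · rw [mul_smul_comm, e1, smul_smul, inv_mul_cancel₀ hn0, one_smul]
    · rw [smul_mul_assoc, e2, smul_smul, inv_mul_cancel₀ hn0, one_smul]

theorem QuaternionAlgebra.isCentral_of_ne_zero (a : F) {c : F} (hc : c ≠ 0) :
    Algebra.IsCentral F ℍ[F,a,1,c] := by
  have h2 : (2 : F) = 0 := CharTwo.two_eq_zero
  refine ⟨fun x hx => ?_⟩
  rw [Subalgebra.mem_center_iff] at hx
  obtain ⟨p, q, r, s⟩ := x
  have h1 := hx ⟨0, 1, 0, 0⟩
  have h3 := hx ⟨0, 0, 1, 0⟩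
  simp at h1 h3
  rw [Algebra.mem_bot]
  refine ⟨p, ?_⟩
  rw [QuaternionAlgebra.algebraMap_eq]
  grind

end

theorem IsQuaternionAlgebra.of_algEquiv {A : Type v} {B : Type w} [DivisionRing A] [DivisionRing B]
    [Algebra F A] [Algebra F B] (e : A ≃ₐ[F] B) (hA : IsQuaternionAlgebra F A) :
    IsQuaternionAlgebra F B where
  central := by
    have := hA.central
    refine ⟨fun x hx => ?_⟩
    have hx' : e.symm x ∈ Subalgebra.center F A := by
      rw [Subalgebra.mem_center_iff] at hx ⊢
      intro b
      apply e.injective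
      simpa using hx (e b)
    rw [Algebra.IsCentral.center_eq_bot, Algebra.mem_bot] at hx'
    obtain ⟨r, hr⟩ := hx'
    exact Algebra.mem_bot.2 ⟨r, by rw [← e.apply_symm_apply x, ← hr, e.commutes]⟩
  simple := inferInstance
  finrank_eq := by rw [← hA.finrank_eq]; exact e.toLinearEquiv.finrank_eq.symm

/-- Over a Kaplansky field any quaternion division algebras are isomorphic, whatever their
universes. -/
theorem IsKaplanskyField.nonempty_algEquiv (hF : IsKaplanskyField F) {A : Type u} {Q : Type v}
    [DivisionRing A] [Algebra F A] [DivisionRing Q] [Algebra F Q] (hA : IsQuaternionAlgebra F A)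
    (hQ : IsQuaternionAlgebra F Q) : Nonempty (A ≃ₐ[F] Q) := by
  have : Module.Finite F Q := Module.finite_of_finrank_pos (by rw [hQ.finrank_eq]; norm_num)
  -- A copy of `Q` in the universe of `F` exists because `Q` is linearly equivalent to `F⁴`.
  have : Small.{u} Q :=
    ⟨_, ⟨(LinearEquiv.ofFinrankEq (R := F) Q (Fin 4 → F)
      (by rw [hQ.finrank_eq, Module.finrank_fin_fun])).toEquiv⟩⟩
  obtain ⟨Q₀, _, _, -, h⟩ := hF
  obtain ⟨e₁⟩ := h A hA
  let e : Shrink.{u} Q ≃ₐ[F] Q := Shrink.algEquiv F Q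
  obtain ⟨e₂⟩ := h (Shrink.{u} Q) (hQ.of_algEquiv e.symm)
  exact ⟨(e₁.trans e₂.symm).trans e⟩

theorem IsKaplanskyField.exists_symbolPair [CharP F 2] (hF : IsKaplanskyField F) {Q : Type v}
    [DivisionRing Q] [Algebra F Q] (hQ : IsQuaternionAlgebra F Q) {a c : F} (hc : c ≠ 0)
    (h : ¬SymbolSplits a c) : ∃ i j : Q, IsSymbolPair a c i j := by
  have h2 : (2 : F) = 0 := CharTwo.two_eq_zero
  let _ : DivisionRing ℍ[F,a,1,c] :=
    DivisionRing.ofIsUnitOrEqZero (QuaternionAlgebra.isUnit_or_eq_zero_of_not_splits hc h)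
  have hA : IsQuaternionAlgebra F ℍ[F,a,1,c] :=
    ⟨QuaternionAlgebra.isCentral_of_ne_zero a hc, inferInstance,
      QuaternionAlgebra.finrank_eq_four _ _ _⟩
  obtain ⟨e⟩ := hF.nonempty_algEquiv hA hQ
  refine ⟨e ⟨0, 1, 0, 0⟩, e ⟨0, 0, 1, 0⟩, ?_, ?_, ?_, ?_⟩
  · rw [← map_mul, ← map_one e, ← map_smul, ← map_add]
    congr 1
    ext <;> simp
  · rw [← map_mul, ← map_mul, ← map_add]
    congr 1
    ext <;> simp
    grind
  · rw [← map_mul, ← map_one e, ← map_smul]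
    congr 1
    ext <;> simp
  · rw [Ne, EmbeddingLike.map_eq_zero_iff]
    intro h0
    simpa using congrArg QuaternionAlgebra.imJ h0

end Kaplansky

/-! ### Bimultiplicativity and the radical of the symbol. -/

section Realizable

variable {F : Type u} [Field F] [CharP F 2] {Q : Type v} [DivisionRing Q] [Algebra F Q]
  {γ : FInvolution F Q}

theorem IsSymbolPair.inv_mul {a c : F} {i j : Q} (P : IsSymbolPair a c i j) :
    j⁻¹ * i = (i + 1) * j⁻¹ := by
  have := charP_two_of_algebra F Q
  rw [inv_mul_eq_iff_eq_mul₀ P.ne, ← mul_assoc, eq_mul_inv_iff_mul_eq₀ P.ne, mul_add, P.ji,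
    mul_one, CharTwo.add_cancel_right]

theorem IsSymbolPair.commute_mul_inv {a c d : F} {i j k : Q} (P : IsSymbolPair a c i j)
    (P' : IsSymbolPair a d i k) : (k * j⁻¹) * i = i * (k * j⁻¹) := by
  have := charP_two_of_algebra F Q
  rw [mul_assoc, P.inv_mul, ← mul_assoc, mul_add, P'.ji, mul_one, CharTwo.add_cancel_right, mul_assoc]

theorem IsSymbolPair.exists_eq_mul {a c d : F} {i j k : Q} (hγ : γ.IsCanonical)
    (P : IsSymbolPair a c i j) (P' : IsSymbolPair a d i k) :
    ∃ x y : F, k = (x • 1 + y • i) * j := by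
  obtain ⟨x, y, h⟩ := hγ.exists_smul_add_of_commute (P.map_left hγ) (P.commute_mul_inv P')
  exact ⟨x, y, by rw [← h, inv_mul_cancel_right₀ P.ne]⟩

theorem IsSymbolPair.exists_conj_left {a c d : F} {i j i' j' : Q} (P : IsSymbolPair a c i j)
    (P' : IsSymbolPair a d i' j') : ∃ k, IsSymbolPair a d i k := by
  obtain ⟨g, hg, h⟩ := exists_conj_of_sq (x := i) (y := i') (t := 1) (n := a)
    (by rw [P.ii, one_smul]) (by rw [P'.ii, one_smul]) ⟨j, P.not_commute⟩
  refine ⟨g⁻¹ * j' * g, ?_⟩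
  have := P'.conj hg
  rwa [mul_assoc _ i', h, inv_mul_cancel_left₀ hg] at this

theorem IsSymbolPair.exists_conj_right {a b c : F} {i j i' j' : Q} (P : IsSymbolPair a c i j)
    (P' : IsSymbolPair b c i' j') : ∃ k, IsSymbolPair b c k j := by
  obtain ⟨g, hg, h⟩ := exists_conj_of_sq (x := j) (y := j') (t := 0) (n := c)
    (by rw [P.jj, zero_smul, zero_add]) (by rw [P'.jj, zero_smul, zero_add])
    ⟨i, P.not_commute.symm⟩
  refine ⟨g⁻¹ * i' * g, ?_⟩
  have := P'.conj hg
  rwa [mul_assoc _ j', h, inv_mul_cancel_left₀ hg] at this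

/-- A suitable scalar makes `w = i + k + scalar` satisfy `w i = (i + 1) w`, while `w` commutes with
`j`. Then `w j⁻¹` lies in `F + F i`, and commuting with `j` kills the coefficient of `i`. -/
theorem IsSymbolPair.exists_eq_add {a b c : F} {i j k : Q} (hγ : γ.IsCanonical)
    (P : IsSymbolPair a c i j) (P' : IsSymbolPair b c k j) :
    ∃ x y : F, k = i + x • 1 + y • j := by
  have := charP_two_of_algebra F Q
  have h2 : (2 : F) = 0 := CharTwo.two_eq_zero
  obtain ⟨t, n, ht, -, -⟩ := hγ.exists_trace_norm (i * k)
  rw [γ.map_mul', P.map_left hγ, P'.map_left hγ] at ht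
  -- `w` is the component of `k` in `F j`
  set w := i + k + (t + 1) • 1 with hw
  have hwi : w * i = i * w + w := by
    simp only [hw, add_mul, mul_add, P.ii, smul_mul_assoc, mul_smul_comm, one_mul, mul_one]
      at ht ⊢
    linear_combination (norm := skip) ht - h2 • i - h2 • (t • 1)
    match_scalars <;> grind
  have hwj : j * w = w * j := by
    simp only [hw, add_mul, mul_add, P.ji, P'.ji, smul_mul_assoc, mul_smul_comm, one_mul, mul_one]
    linear_combination (norm := skip) h2 • j
    match_scalars <;> grind
  have hk : k = i + w + (t + 1) • 1 := by
    rw [hw]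
    match_scalars <;> grind
  by_cases hw0 : w = 0
  · exact ⟨t + 1, 0, by rw [hk, hw0]; module⟩
  obtain ⟨p, q, h⟩ := hγ.exists_smul_add_of_commute (P.map_left hγ) (e := w * j⁻¹) (by
    rw [mul_assoc, P.inv_mul, ← mul_assoc, mul_add, hwi, mul_one, CharTwo.add_cancel_right, mul_assoc])
  have hwp : w = (p • 1 + q • i) * j := by rw [← h, inv_mul_cancel_right₀ P.ne]
  have hq : q = 0 := by
    rw [hwp] at hwj
    simp only [add_mul, mul_add, ← mul_assoc, P.ji, smul_mul_assoc, mul_smul_comm, one_mul,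
      P.jj] at hwj
    simp only [smul_add, add_right_inj, add_eq_left, smul_eq_zero, mul_assoc, P.jj,
      mul_smul_comm, mul_one, one_ne_zero, P.ne_zero, or_false] at hwj
    exact hwj
  refine ⟨t + 1, p, ?_⟩
  conv_lhs => rw [hk, hwp, hq]
  simp only [zero_smul, add_zero, smul_mul_assoc, one_mul]
  abel

/-- Every division algebra given by a symbol is isomorphic to `Q`. -/
def SymbolRealizable (F : Type u) (Q : Type v) [Field F] [DivisionRing Q] [Algebra F Q] : Prop :=
  ∀ a c : F, c ≠ 0 → ¬SymbolSplits a c → ∃ i j : Q, IsSymbolPair a c i j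

/-- Two nonsplit symbols with a common slot are realized in `Q` with a common generator. Writing the
other generator of the second pair in terms of the first pair, its quadratic equation becomes the
desired splitting. -/
theorem SymbolRealizable.symbolBimultiplicative (hQ : SymbolRealizable F Q)
    (hγ : γ.IsCanonical) : SymbolBimultiplicative F := by
  have h2 : (2 : F) = 0 := CharTwo.two_eq_zero
  constructor
  · intro a b c hc ha hb
    obtain ⟨i, j, P⟩ := hQ a c hc ha
    obtain ⟨i', j', P'⟩ := hQ b c hc hb
    obtain ⟨k, P'⟩ := P.exists_conj_right P'
    obtain ⟨x, y, rfl⟩ := P.exists_eq_add hγ P'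
    refine ⟨y, x, ?_⟩
    have h := P'.ii
    simp only [add_mul, mul_add, P.ii, P.ji, P.jj, smul_mul_assoc, mul_smul_comm, one_mul, mul_one]
      at h
    refine smul_one_injective (Q := Q) ?_
    linear_combination (norm := skip) h - h2 • (b • 1)
    match_scalars <;> grind
  · intro a c d hc hd h h'
    obtain ⟨i, j, P⟩ := hQ a c hc h
    obtain ⟨i', j', P'⟩ := hQ a d hd h'
    obtain ⟨k, P'⟩ := P.exists_conj_left P'
    obtain ⟨x, y, rfl⟩ := P.exists_eq_mul hγ P'
    rw [symbolSplits_iff_norm (mul_ne_zero hc hd)]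
    refine ⟨c * x, c * y, ?_⟩
    have h := P'.jj
    simp only [add_mul, mul_add, P.ii, P.jj, P.ji_mul, smul_mul_assoc,
      mul_smul_comm, one_mul, mul_one, mul_assoc] at h
    have e : d = c * (x ^ 2 + x * y + a * y ^ 2) := by
      refine smul_one_injective (Q := Q) ?_
      linear_combination (norm := skip) -h
      match_scalars <;> grind
    rw [e]
    ring

theorem SymbolRealizable.exists_of_not_symbolRadical (hQ : SymbolRealizable F Q)
    (hγ : γ.IsCanonical) {a : F} (ha : ¬SymbolRadical a) :
    ∃ i : Q, γ i = i + 1 ∧ i * i = i + a • 1 := by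
  simp only [SymbolRadical, not_forall] at ha
  obtain ⟨c, hc, h⟩ := ha
  obtain ⟨i, j, P⟩ := hQ a c hc h
  exact ⟨i, P.map_left hγ, P.ii⟩

variable [Algebra.IsCentral F Q]

theorem not_symbolRadical_of_map (hγ : γ.IsCanonical) {i : Q} {a : F} (hi : γ i = i + 1)
    (hii : i * i = i + a • 1) : ¬SymbolRadical a := fun h => by
  obtain ⟨c, j, P⟩ := exists_symbolPair_of_map hγ hi hii
  exact P.not_splits hγ (h c P.ne_zero)

/-- If `γ` were the identity, `Q` would be commutative, hence equal to its centre `F`. So some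
element has nonzero trace and can be normalized. -/
theorem exists_symbolPair (hγ : γ.IsCanonical) (hdim : Module.finrank F Q = 4) :
    ∃ (a c : F) (i j : Q), IsSymbolPair a c i j := by
  have hx : ∃ x : Q, γ x ≠ x := by
    by_contra! hid
    have hcen : Subalgebra.center F Q = ⊤ := by
      rw [eq_top_iff]
      intro x _
      rw [Subalgebra.mem_center_iff]
      intro b
      rw [← hid (b * x), γ.map_mul', hid, hid]
    rw [Algebra.IsCentral.center_eq_bot] at hcen
    have h1 : Module.finrank F (⊥ : Subalgebra F Q) = Module.finrank F (⊤ : Subalgebra F Q) := by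
      rw [hcen]
    rw [Subalgebra.finrank_bot, subalgebra_top_finrank_eq_submodule_top_finrank, finrank_top,
      hdim] at h1
    norm_num at h1
  obtain ⟨x, hx⟩ := hx
  obtain ⟨t, n, ht, -, h3⟩ := hγ.exists_trace_norm x
  have ht0 : t ≠ 0 := by
    rintro rfl
    simp [ht] at hx
  obtain ⟨c, j, P⟩ := exists_symbolPair_of_map hγ (i := t⁻¹ • x) (a := t⁻¹ * t⁻¹ * n)
    (by rw [map_smul, ht, smul_add, smul_smul, inv_mul_cancel₀ ht0, one_smul])
    (by
      rw [smul_mul_smul_comm, h3, smul_add, smul_smul, smul_smul, mul_assoc t⁻¹ t⁻¹ t,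
        inv_mul_cancel₀ ht0, mul_one])
  exact ⟨_, c, _, j, P⟩

/-- The radical of the symbol has index greater than two. -/
theorem exists_not_symbolRadical_add (hγ : γ.IsCanonical)
    (hdim : Module.finrank F Q = 4) (d : F) :
    ∃ b : F, ¬SymbolRadical b ∧ ¬SymbolRadical (d + b) := by
  have h2 : (2 : F) = 0 := CharTwo.two_eq_zero
  by_contra! hcon
  obtain ⟨a, c, i, j, P⟩ := exists_symbolPair hγ hdim
  -- Both `i` and `i + (x + y i) j` have trace one, so their invariants are not radical; by
  -- assumption both lie in the same coset of the radical, and this is their difference.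
  have key : ∀ x y : F, SymbolRadical (c * (x ^ 2 + x * y + a * y ^ 2)) := by
    intro x y
    have e1 := hcon a (not_symbolRadical_of_map hγ (P.map_left hγ) P.ii)
    have e2 := hcon (a + c * (x ^ 2 + x * y + a * y ^ 2)) (not_symbolRadical_of_map hγ
      (i := i + (x • 1 + y • i) * j) (by
        simp only [map_add, map_smul, γ.map_mul', P.map_left hγ, P.map_right hγ,
          mul_add, add_mul, P.ji, smul_mul_assoc, one_mul, mul_one]
        match_scalars <;> grind) (by
        simp only [add_mul, mul_add, P.ii, P.ji, P.jj, P.ii_mul, P.ji_mul, smul_mul_assoc,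
          mul_smul_comm, one_mul, mul_one, mul_assoc]
        match_scalars <;> grind))
    rw [← add_assoc] at e2
    exact e2.of_add_left e1
  -- With `N = X² + XY + aY²`, `N(1, y) + N(0, y) + N(1, 0) = y` in characteristic two; take `y = z
  -- / c`.
  have all : ∀ z : F, SymbolRadical z := by
    intro z
    have h := ((key 1 (z / c)).add (key 0 (z / c))).add (key 1 0)
    have hc := P.ne_zero
    convert h using 1
    field_simp
    grind
  exact not_symbolRadical_of_map hγ (P.map_left hγ) P.ii (all a)

theorem exists_not_symbolRadical_add_add (hγ : γ.IsCanonical)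
    (hdim : Module.finrank F Q = 4) (d e : F) :
    ∃ b : F, ¬SymbolRadical b ∧ ¬SymbolRadical (d + b) ∧ ¬SymbolRadical (e + b) := by
  by_cases hd : SymbolRadical d
  · obtain ⟨b, hb, hb'⟩ := exists_not_symbolRadical_add hγ hdim e
    exact ⟨b, hb, fun h => hb (h.of_add_left hd), hb'⟩
  by_cases he : SymbolRadical e
  · obtain ⟨b, hb, hb'⟩ := exists_not_symbolRadical_add hγ hdim d
    exact ⟨b, hb, hb', fun h => hb (h.of_add_left he)⟩
  by_cases hde : SymbolRadical (d + e)
  · obtain ⟨b, hb, hb'⟩ := exists_not_symbolRadical_add hγ hdim d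
    refine ⟨b, hb, hb', fun h => hb' ?_⟩
    have := hde.add h
    rwa [add_assoc, CharTwo.add_cancel_left] at this
  · refine ⟨d + e, hde, ?_, ?_⟩
    · rwa [CharTwo.add_cancel_left]
    · rwa [add_comm d, CharTwo.add_cancel_left]

end Realizable

/-! ### Invariants and values of one-dimensional forms. -/

/-- `a` has reduced trace `t ≠ 0`, and `t⁻¹ a` has reduced norm `δ`. -/
structure IsArtinSchreier {F : Type u} {Q : Type v} [Field F] [DivisionRing Q] [Algebra F Q]
    (γ : FInvolution F Q) (a : Q) (t δ : F) : Prop where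
  map : γ a = a + t • 1
  sq : a * a = t • a + (t ^ 2 * δ) • 1
  ne : t ≠ 0

namespace IsArtinSchreier

variable {F : Type u} [Field F] {Q : Type v} [DivisionRing Q] [Algebra F Q]
  {γ : FInvolution F Q}

theorem normalize {a : Q} {t δ : F} (h : IsArtinSchreier γ a t δ) :
    γ (t⁻¹ • a) = t⁻¹ • a + 1 ∧ (t⁻¹ • a) * (t⁻¹ • a) = t⁻¹ • a + δ • 1 := by
  have ht := h.ne
  constructor
  · rw [map_smul, h.map, smul_add, smul_smul, inv_mul_cancel₀ ht, one_smul]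
  · rw [smul_mul_smul_comm, h.sq]
    match_scalars <;> field_simp

theorem of_one {i : Q} {δ : F} (hi : γ i = i + 1) (hii : i * i = i + δ • 1) :
    IsArtinSchreier γ i 1 δ :=
  ⟨by rw [hi, one_smul], by rw [hii, one_smul, one_pow, one_mul], one_ne_zero⟩

end IsArtinSchreier

section Values

variable {F : Type u} [Field F] [CharP F 2] {Q : Type v} [DivisionRing Q] [Algebra F Q]
  {γ : FInvolution F Q}

theorem exists_isArtinSchreier (hγ : γ.IsCanonical) {a : Q} (ha : γ a ≠ a) :
    ∃ t δ : F, IsArtinSchreier γ a t δ := by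
  obtain ⟨t, n, ht, -, h⟩ := hγ.exists_trace_norm a
  have ht0 : t ≠ 0 := by
    rintro rfl
    simp [ht] at ha
  exact ⟨t, n / t ^ 2, ht, by rw [mul_div_cancel₀ _ (pow_ne_zero 2 ht0), h], ht0⟩

namespace IsArtinSchreier

theorem not_symbolRadical [Algebra.IsCentral F Q] (hγ : γ.IsCanonical) {a : Q} {t δ : F}
    (h : IsArtinSchreier γ a t δ) : ¬SymbolRadical δ :=
  not_symbolRadical_of_map hγ h.normalize.1 h.normalize.2

theorem conj (hγ : γ.IsCanonical) {a : Q} {t δ : F} (h : IsArtinSchreier γ a t δ) {d : Q}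
    (hd : d ≠ 0) : ∃ s : F, IsArtinSchreier γ (γ d * a * d) s δ := by
  obtain ⟨n, hn0, hn⟩ := hγ.exists_norm hd
  have hn' : d * γ d = n • 1 := by
    apply mul_right_cancel₀ hd
    rw [mul_assoc, hn, mul_smul_comm, mul_one, smul_one_mul]
  refine ⟨n * t, ?_, ?_, mul_ne_zero hn0 h.ne⟩
  · rw [γ.map_mul', γ.map_mul', γ.invol', h.map, add_mul, mul_add, smul_one_mul, mul_smul_comm,
      hn, smul_smul, mul_comm t n, mul_assoc]
  · have e : γ d * a * d * (γ d * a * d) = n • (γ d * (a * a) * d) := by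
      rw [show γ d * a * d * (γ d * a * d) = γ d * a * (d * γ d) * a * d by simp only [mul_assoc],
        hn']
      simp only [mul_smul_comm, smul_mul_assoc, mul_one, mul_assoc]
    rw [e, h.sq, mul_add, add_mul, mul_smul_comm, smul_mul_assoc, mul_smul_comm, smul_mul_assoc,
      mul_one, hn]
    match_scalars <;> ring

/-- The one-dimensional form of `a` represents all the multiples of all the elements with the same
Arf invariant. -/
theorem exists_value [Algebra.IsCentral F Q] (hγ : γ.IsCanonical)
    (hQ : SymbolRealizable F Q) {a x : Q} {t δ : F} (h : IsArtinSchreier γ a t δ)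
    (hx : γ x = x + 1) (hxx : x * x = x + δ • 1) (s : F) :
    ∃ (d : Q) (f : F), (d = 0 → s = 0) ∧ γ d * a * d = s • x + f • 1 := by
  have h2 : (2 : F) = 0 := CharTwo.two_eq_zero
  have H := hQ.symbolBimultiplicative hγ
  by_cases hs : s = 0
  · exact ⟨0, 0, fun _ => hs, by simp [hs]⟩
  obtain ⟨hu, huu⟩ := h.normalize
  set u := t⁻¹ • a with hu_def
  have ha : a = t • u := by rw [hu_def, smul_smul, mul_inv_cancel₀ h.ne, one_smul]
  obtain ⟨b, j, P⟩ := exists_symbolPair_of_map hγ hu huu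
  obtain ⟨b', j', P'⟩ := exists_symbolPair_of_map hγ hx hxx
  obtain ⟨g, hg, hgx⟩ := exists_conj_of_sq (x := x) (y := u) (t := 1) (n := δ)
    (by rw [hxx, one_smul]) (by rw [huu, one_smul]) ⟨j', P'.not_commute⟩
  obtain ⟨n, hn0, hn⟩ := hγ.exists_norm hg
  -- If `r` is a norm from `F(u)`, an element of `F(u)` of norm `r` works. Otherwise `r b` is a
  -- norm, and the extra factor `j` replaces `u` by `u + 1`, which only adds a scalar.
  have key : ∀ r : F, r ≠ 0 → ∃ (d : Q) (f : F), γ d * u * d = r • u + f • 1 := by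
    intro r hr
    by_cases hrs : SymbolSplits δ r
    · obtain ⟨p, q, hpq⟩ := (symbolSplits_iff_norm hr).1 hrs
      refine ⟨p • 1 + q • u, 0, ?_⟩
      simp only [map_add, map_smul, γ.map_one, hu]
      simp only [add_mul, mul_add, smul_mul_assoc, mul_smul_comm, one_mul, mul_one, huu, hpq]
      match_scalars <;> grind
    · obtain ⟨p, q, hpq⟩ := (symbolSplits_iff_norm (mul_ne_zero hr P.ne_zero)).1
        (H.mul _ _ _ hr P.ne_zero hrs (P.not_splits hγ))
      refine ⟨b⁻¹ • ((p • 1 + q • u) * j), r, ?_⟩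
      have e : γ ((p • 1 + q • u) * j) * u * ((p • 1 + q • u) * j) =
          (b * (r * b)) • (u + 1) := by
        simp only [γ.map_mul', map_add, map_smul, γ.map_one, P.map_left hγ, P.map_right hγ]
        simp only [add_mul, mul_add, smul_mul_assoc, mul_smul_comm, one_mul, mul_one, mul_assoc,
          P.ii, P.ji, P.jj, P.ii_mul, P.ji_mul, hpq]
        match_scalars <;> grind
      have hb := P.ne_zero
      rw [map_smul, smul_mul_assoc, smul_mul_smul_comm, e]
      match_scalars <;> field_simp
  -- The factor `t` comes from `a = t u`, and `n` from `γ(g) u g = n x`.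
  obtain ⟨d, f, hd⟩ := key (s / (t * n)) (div_ne_zero hs (mul_ne_zero h.ne hn0))
  have e : γ (d * g) * a * (d * g) = s • x + (t * f * n) • 1 := by
    have e1 : γ (d * g) * a * (d * g) = t • (γ g * (γ d * u * d) * g) := by
      rw [ha, γ.map_mul']
      simp only [mul_smul_comm, smul_mul_assoc, mul_assoc]
    have e2 : γ g * u * g = n • x := by
      rw [mul_assoc, hgx, ← mul_assoc, hn, smul_one_mul]
    rw [e1, hd, mul_add, add_mul, mul_smul_comm, smul_mul_assoc, e2, mul_smul_comm,
      smul_mul_assoc, mul_one, hn]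
    have := h.ne
    match_scalars <;> field_simp
  refine ⟨d * g, t * f * n, fun h0 => ?_, e⟩
  rw [h0] at e
  by_contra
  apply ne_smul_one_of_not_commute P'.not_commute (s⁻¹ * (t * f * n))
  have := charP_two_of_algebra F Q
  rw [mul_zero, eq_comm, CharTwo.add_eq_zero] at e
  rw [mul_smul, ← e, smul_smul, inv_mul_cancel₀ hs, one_smul]

/-- An explicit combination of `v₁`, `v₂` and `1` has trace one and norm `δ₁ + δ₂ + δ₃`. This is the
obstruction behind the anisotropic form of dimension three. -/
theorem not_symbolRadical_add_add [Algebra.IsCentral F Q] (hγ : γ.IsCanonical) {v₁ v₂ v₃ : Q}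
    {t₁ t₂ t₃ δ₁ δ₂ δ₃ f : F} (h₁ : IsArtinSchreier γ v₁ t₁ δ₁) (h₂ : IsArtinSchreier γ v₂ t₂ δ₂)
    (h₃ : IsArtinSchreier γ v₃ t₃ δ₃) (h : v₁ + v₂ + v₃ = f • 1) :
    ¬SymbolRadical (δ₁ + δ₂ + δ₃) := by
  have h2 : (2 : F) = 0 := CharTwo.two_eq_zero
  have hv : v₃ = v₁ + v₂ + f • 1 := by
    linear_combination (norm := module) h - h2 • (v₁ + v₂)
  have ht : t₃ = t₁ + t₂ := by
    have := congrArg γ hv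
    simp only [map_add, map_smul, γ.map_one, h₁.map, h₂.map, h₃.map] at this
    refine smul_one_injective (Q := Q) ?_
    linear_combination (norm := module) this - hv
  have e := h₃.sq
  rw [hv] at e
  simp only [add_mul, mul_add, smul_mul_assoc, mul_smul_comm, one_mul, mul_one, h₁.sq, h₂.sq] at e
  have n1 := h₁.ne
  have n2 := h₂.ne
  have n3 : t₁ + t₂ ≠ 0 := ht ▸ h₃.ne
  refine not_symbolRadical_of_map hγ
    (i := t₃⁻¹ • ((t₁⁻¹ * t₂) • v₁ + (t₂⁻¹ * t₁) • v₂ + f • 1)) ?_ ?_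
  · simp only [map_add, map_smul, γ.map_one, h₁.map, h₂.map, ht]
    match_scalars <;> field_simp
    grind
  · rw [smul_mul_smul_comm]
    simp only [add_mul, mul_add, smul_mul_assoc, mul_smul_comm, one_mul, mul_one, h₁.sq, h₂.sq]
    subst ht
    linear_combination (norm := skip) ((t₁ + t₂)⁻¹ * (t₁ + t₂)⁻¹) • e
    match_scalars <;> field_simp <;> grind

/-- The traces agree, so the normalized elements differ by `f / t₂`, and the invariants by `(f /
t₂)² + f / t₂`. -/
theorem symbolRadical_add {v₁ v₂ : Q} {t₁ t₂ δ₁ δ₂ f : F}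
    (h₁ : IsArtinSchreier γ v₁ t₁ δ₁) (h₂ : IsArtinSchreier γ v₂ t₂ δ₂) (h : v₁ + v₂ = f • 1) :
    SymbolRadical (δ₁ + δ₂) := by
  have h2 : (2 : F) = 0 := CharTwo.two_eq_zero
  have hv : v₂ = v₁ + f • 1 := by
    linear_combination (norm := module) h - h2 • v₁
  have ht : t₂ = t₁ := by
    have := congrArg γ hv
    simp only [map_add, map_smul, γ.map_one, h₁.map, h₂.map] at this
    refine smul_one_injective (Q := Q) ?_
    linear_combination (norm := module) this - hv
  subst ht
  have e := h₂.sq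
  rw [hv] at e
  simp only [add_mul, mul_add, smul_mul_assoc, mul_smul_comm, one_mul, mul_one, h₁.sq] at e
  have n2 := h₂.ne
  have e' : t₂ ^ 2 * δ₁ + f * f = t₂ * f + t₂ ^ 2 * δ₂ := by
    refine smul_one_injective (Q := Q) ?_
    linear_combination (norm := skip) e
    match_scalars <;> grind
  refine fun c _ => ⟨0, f / t₂, ?_⟩
  field_simp
  grind

end IsArtinSchreier

end Values

/-! ### Sums of values lying in `F`. -/

section Isotropy

variable {F : Type u} [Field F] [CharP F 2] {Q : Type v} [DivisionRing Q] [Algebra F Q]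
  [Algebra.IsCentral F Q] {γ : FInvolution F Q}

/-- With a common slot `c`, the three invariants are realized by `i`, `i + y₂ j`, `i + y₃ j` up to
scalars: three vectors in a plane modulo `F`. -/
theorem exists_value_three (hγ : γ.IsCanonical) (hQ : SymbolRealizable F Q) {a₁ a₂ a₃ : Q}
    {t₁ t₂ t₃ δ₁ δ₂ δ₃ : F} (h₁ : IsArtinSchreier γ a₁ t₁ δ₁) (h₂ : IsArtinSchreier γ a₂ t₂ δ₂)
    (h₃ : IsArtinSchreier γ a₃ t₃ δ₃) (h : ¬SymbolRadical (δ₁ + δ₂ + δ₃)) :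
    ∃ (d₁ d₂ d₃ : Q) (f : F), ¬(d₁ = 0 ∧ d₂ = 0 ∧ d₃ = 0) ∧
      γ d₁ * a₁ * d₁ + γ d₂ * a₂ * d₂ + γ d₃ * a₃ * d₃ = f • 1 := by
  have h2 : (2 : F) = 0 := CharTwo.two_eq_zero
  obtain ⟨c, hc, n₁, n₂, n₃⟩ := (hQ.symbolBimultiplicative hγ).exists_not_splits_three
    (h₁.not_symbolRadical hγ) (h₂.not_symbolRadical hγ) (h₃.not_symbolRadical hγ) h
  obtain ⟨i, j, P⟩ := hQ _ c hc n₁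
  obtain ⟨_, _, P₂⟩ := hQ _ c hc n₂
  obtain ⟨_, _, P₃⟩ := hQ _ c hc n₃
  obtain ⟨_, P₂⟩ := P.exists_conj_right P₂
  obtain ⟨_, P₃⟩ := P.exists_conj_right P₃
  obtain ⟨x₂, y₂, rfl⟩ := P.exists_eq_add hγ P₂
  obtain ⟨x₃, y₃, rfl⟩ := P.exists_eq_add hγ P₃
  obtain ⟨s₁, s₂, s₃, hs, hsum, hy⟩ : ∃ s₁ s₂ s₃ : F, ¬(s₁ = 0 ∧ s₂ = 0 ∧ s₃ = 0) ∧
      s₁ + s₂ + s₃ = 0 ∧ s₂ * y₂ + s₃ * y₃ = 0 := by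
    by_cases hy : y₂ = 0 ∧ y₃ = 0
    · exact ⟨1, 1, 0, by simp, by grind, by simp [hy]⟩
    · exact ⟨y₂ + y₃, y₃, y₂, by tauto, by grind, by grind⟩
  obtain ⟨d₁, f₁, hd₁, e₁⟩ := h₁.exists_value hγ hQ (P.map_left hγ) P.ii s₁
  obtain ⟨d₂, f₂, hd₂, e₂⟩ := h₂.exists_value hγ hQ (P₂.map_left hγ) P₂.ii s₂
  obtain ⟨d₃, f₃, hd₃, e₃⟩ := h₃.exists_value hγ hQ (P₃.map_left hγ) P₃.ii s₃
  refine ⟨d₁, d₂, d₃, f₁ + f₂ + f₃ + s₂ * x₂ + s₃ * x₃, by tauto, ?_⟩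
  rw [e₁, e₂, e₃]
  linear_combination (norm := module) hsum • i + hy • j

/-- The generator `i` of invariant `b` serves both slots. The four trace-one elements then lie,
modulo `F`, in the span of `i`, `j`, `j'`, so they are dependent. -/
theorem exists_value_four (hγ : γ.IsCanonical) (hQ : SymbolRealizable F Q)
    (hdim : Module.finrank F Q = 4) {a₁ a₂ a₃ a₄ : Q} (h₁ : γ a₁ ≠ a₁) (h₂ : γ a₂ ≠ a₂)
    (h₃ : γ a₃ ≠ a₃) (h₄ : γ a₄ ≠ a₄) :
    ∃ (d₁ d₂ d₃ d₄ : Q) (f : F), ¬(d₁ = 0 ∧ d₂ = 0 ∧ d₃ = 0 ∧ d₄ = 0) ∧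
      γ d₁ * a₁ * d₁ + γ d₂ * a₂ * d₂ + γ d₃ * a₃ * d₃ + γ d₄ * a₄ * d₄ = f • 1 := by
  have h2 : (2 : F) = 0 := CharTwo.two_eq_zero
  have H := hQ.symbolBimultiplicative hγ
  obtain ⟨t₁, δ₁, h₁⟩ := exists_isArtinSchreier hγ h₁
  obtain ⟨t₂, δ₂, h₂⟩ := exists_isArtinSchreier hγ h₂
  obtain ⟨t₃, δ₃, h₃⟩ := exists_isArtinSchreier hγ h₃
  obtain ⟨t₄, δ₄, h₄⟩ := exists_isArtinSchreier hγ h₄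
  obtain ⟨b, hb, hb₁, hb₂⟩ := exists_not_symbolRadical_add_add hγ hdim (δ₁ + δ₂) (δ₃ + δ₄)
  obtain ⟨c, hc, n₁, n₂, n⟩ := H.exists_not_splits_three
    (h₁.not_symbolRadical hγ) (h₂.not_symbolRadical hγ) hb hb₁
  obtain ⟨c', hc', n₃, n₄, n'⟩ := H.exists_not_splits_three
    (h₃.not_symbolRadical hγ) (h₄.not_symbolRadical hγ) hb hb₂
  obtain ⟨i, j, P⟩ := hQ _ c hc n
  obtain ⟨_, _, P'⟩ := hQ _ c' hc' n'
  obtain ⟨j', P'⟩ := P.exists_conj_left P'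
  obtain ⟨_, _, P₁⟩ := hQ _ c hc n₁
  obtain ⟨_, _, P₂⟩ := hQ _ c hc n₂
  obtain ⟨_, _, P₃⟩ := hQ _ c' hc' n₃
  obtain ⟨_, _, P₄⟩ := hQ _ c' hc' n₄
  obtain ⟨_, P₁⟩ := P.exists_conj_right P₁
  obtain ⟨_, P₂⟩ := P.exists_conj_right P₂
  obtain ⟨_, P₃⟩ := P'.exists_conj_right P₃
  obtain ⟨_, P₄⟩ := P'.exists_conj_right P₄
  obtain ⟨x₁, y₁, rfl⟩ := P.exists_eq_add hγ P₁
  obtain ⟨x₂, y₂, rfl⟩ := P.exists_eq_add hγ P₂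
  obtain ⟨x₃, y₃, rfl⟩ := P'.exists_eq_add hγ P₃
  obtain ⟨x₄, y₄, rfl⟩ := P'.exists_eq_add hγ P₄
  obtain ⟨s₁, s₂, s₃, s₄, hs, hsum, hy, hy'⟩ : ∃ s₁ s₂ s₃ s₄ : F,
      ¬(s₁ = 0 ∧ s₂ = 0 ∧ s₃ = 0 ∧ s₄ = 0) ∧ s₁ + s₂ + s₃ + s₄ = 0 ∧
      s₁ * y₁ + s₂ * y₂ = 0 ∧ s₃ * y₃ + s₄ * y₄ = 0 := by
    by_cases hy : y₁ = y₂
    · exact ⟨1, 1, 0, 0, by simp, by grind, by grind, by grind⟩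
    by_cases hy' : y₃ = y₄
    · exact ⟨0, 0, 1, 1, by simp, by grind, by grind, by grind⟩
    -- Each pair cancels its own `j`-part; the cross factors make both pairs sum to `(y₁ + y₂)(y₃ +
    -- y₄)`.
    refine ⟨(y₃ + y₄) * y₂, (y₃ + y₄) * y₁, (y₁ + y₂) * y₄, (y₁ + y₂) * y₃, ?_, by grind,
      by grind, by grind⟩
    have e : y₃ + y₄ ≠ 0 := by rwa [Ne, CharTwo.add_eq_zero]
    rintro ⟨e₁, e₂, -⟩
    exact hy ((mul_eq_zero.1 e₂).resolve_left e ▸ ((mul_eq_zero.1 e₁).resolve_left e).symm)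
  obtain ⟨d₁, f₁, hd₁, e₁⟩ := h₁.exists_value hγ hQ (P₁.map_left hγ) P₁.ii s₁
  obtain ⟨d₂, f₂, hd₂, e₂⟩ := h₂.exists_value hγ hQ (P₂.map_left hγ) P₂.ii s₂
  obtain ⟨d₃, f₃, hd₃, e₃⟩ := h₃.exists_value hγ hQ (P₃.map_left hγ) P₃.ii s₃
  obtain ⟨d₄, f₄, hd₄, e₄⟩ := h₄.exists_value hγ hQ (P₄.map_left hγ) P₄.ii s₄
  refine ⟨d₁, d₂, d₃, d₄, f₁ + f₂ + f₃ + f₄ + s₁ * x₁ + s₂ * x₂ + s₃ * x₃ + s₄ * x₄, by tauto, ?_⟩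
  rw [e₁, e₂, e₃, e₄]
  linear_combination (norm := module) hsum • i + hy • j + hy' • j'

theorem exists_polar_ne_zero (hγ : γ.IsCanonical) {z : Q} (hz : γ z = z)
    (hzF : ∀ r : F, z ≠ r • 1) :
    ∃ (e : Q) (τ : F), γ e = e ∧ τ ≠ 0 ∧ z * e = e * z + τ • 1 := by
  have := charP_two_of_algebra F Q
  have h2 : (2 : F) = 0 := CharTwo.two_eq_zero
  suffices ∃ e, γ e = e ∧ z * e ≠ e * z by
    obtain ⟨e, he, hne⟩ := this
    obtain ⟨τ, n, ht, -, -⟩ := hγ.exists_trace_norm (e * z)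
    rw [γ.map_mul', he, hz] at ht
    refine ⟨e, τ, he, ?_, ht⟩
    rintro rfl
    simp [ht] at hne
  obtain ⟨m, hm⟩ : ∃ m, z * m ≠ m * z := by
    by_contra! hc
    have hz' : z ∈ Subalgebra.center F Q := Subalgebra.mem_center_iff.2 fun b => (hc b).symm
    rw [Algebra.IsCentral.center_eq_bot, Algebra.mem_bot] at hz'
    obtain ⟨r, hr⟩ := hz'
    exact hzF r (by rw [← hr, Algebra.algebraMap_eq_smul_one])
  obtain ⟨s, n, hs, -, -⟩ := hγ.exists_trace_norm m
  by_cases hs0 : s = 0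
  · exact ⟨m, by rw [hs, hs0, zero_smul, add_zero], hm⟩
  obtain ⟨ρ, n', hρ, -, -⟩ := hγ.exists_trace_norm (z * m)
  -- The multiple of `m` cancels the trace of `z m`; the commutator with `z` is `(z + ρ / s)(z m - m
  -- z) ≠ 0`.
  refine ⟨z * m + (ρ / s) • m, ?_, ?_⟩
  · rw [map_add, map_smul, hρ, hs]
    match_scalars <;> field_simp
    grind
  · intro h
    have h0 : (z + (ρ / s) • 1) * (z * m - m * z) = 0 := by
      simp only [mul_add, add_mul, mul_sub, smul_mul_assoc, one_mul, mul_smul_comm,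
        ← mul_assoc] at h ⊢
      linear_combination (norm := module) h
    rcases mul_eq_zero.1 h0 with h0 | h0
    · rw [CharTwo.add_eq_zero] at h0
      exact hzF _ h0
    · exact hm (sub_eq_zero.1 h0)

/-- Replacing `a₁` by `a₁ + γ(d) z d` keeps its trace but moves its invariant, so `d` can be chosen
to make `exists_value_three` applicable. -/
theorem exists_value_three_one (hγ : γ.IsCanonical) (hQ : SymbolRealizable F Q)
    {a₁ a₂ a₃ z : Q} (h₁ : γ a₁ ≠ a₁) (h₂ : γ a₂ ≠ a₂) (h₃ : γ a₃ ≠ a₃) (hz : γ z = z) :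
    ∃ (d₁ d₂ d₃ e : Q) (f : F), ¬(d₁ = 0 ∧ d₂ = 0 ∧ d₃ = 0 ∧ e = 0) ∧
      γ d₁ * a₁ * d₁ + γ d₂ * a₂ * d₂ + γ d₃ * a₃ * d₃ + γ e * z * e = f • 1 := by
  have h2 : (2 : F) = 0 := CharTwo.two_eq_zero
  by_cases hzF : ∃ r : F, z = r • 1
  · obtain ⟨r, hr⟩ := hzF
    exact ⟨0, 0, 0, 1, r, by simp, by simp [γ.map_one, hr]⟩
  push Not at hzF
  obtain ⟨e, τ, he, hτ, hze⟩ := exists_polar_ne_zero hγ hz hzF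
  obtain ⟨t, δ, h₁⟩ := exists_isArtinSchreier hγ h₁
  obtain ⟨t₂, δ₂, h₂⟩ := exists_isArtinSchreier hγ h₂
  obtain ⟨t₃, δ₃, h₃⟩ := exists_isArtinSchreier hγ h₃
  have ht := h₁.ne
  have trace : ∀ d : Q, γ (a₁ + γ d * z * d) = a₁ + γ d * z * d + t • 1 := fun d => by
    rw [map_add, γ.map_mul', γ.map_mul', γ.invol', hz, h₁.map, mul_assoc]
    abel
  have norm : ∀ d : Q, ∃ δ' : F, IsArtinSchreier γ (a₁ + γ d * z * d) t δ' := fun d => by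
    obtain ⟨s, δ', h⟩ := exists_isArtinSchreier hγ (a := a₁ + γ d * z * d) (by
      rw [trace]
      simpa using ht)
    have hst : s = t := by
      have := h.map
      rw [trace] at this
      exact smul_one_injective (add_left_cancel this).symm
    exact ⟨δ', hst ▸ h⟩
  choose δ' hδ' using norm
  obtain ⟨d, hd⟩ : ∃ d : Q, ¬SymbolRadical (δ' d + δ₂ + δ₃) := by
    by_contra! hcon
    refine h₁.not_symbolRadical hγ ?_
    -- This second difference of the invariant takes every value in `F` as `l` varies, so the
    -- invariants cannot all stay in one coset of the radical.
    have key : ∀ l : F, δ' (1 + l • e) + δ' 1 + δ' (l • e) + δ' 0 = l * τ / t := by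
      intro l
      have g₁ := (hδ' (1 + l • e)).sq
      have g₂ := (hδ' 1).sq
      have g₃ := (hδ' (l • e)).sq
      have g₄ := (hδ' 0).sq
      obtain ⟨t', n', ht', -, hzz⟩ := hγ.exists_trace_norm z
      obtain ⟨s', m', hs', -, hee⟩ := hγ.exists_trace_norm e
      have ht0 : t' = 0 := by simpa [hz] using ht'
      have hs0 : s' = 0 := by simpa [he] using hs'
      rw [ht0, zero_smul, zero_add] at hzz
      rw [hs0, zero_smul, zero_add] at hee
      have hze' : ∀ x, z * (e * x) = e * (z * x) + τ • x := fun x => by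
        rw [← mul_assoc, hze, add_mul, mul_assoc, smul_one_mul]
      have hee' : ∀ x, e * (e * x) = m' • x := fun x => by
        rw [← mul_assoc, hee, smul_one_mul]
      simp only [map_add, map_smul, γ.map_one, he, map_zero, zero_mul, mul_zero, add_zero,
        add_mul, mul_add, one_mul, mul_one, smul_mul_assoc, mul_smul_comm, mul_assoc, hzz, hee,
        hze, hee', hze', h₁.sq, smul_add] at g₁ g₂ g₃ g₄
      have : t ^ 2 * (δ' (1 + l • e) + δ' 1 + δ' (l • e) + δ' 0) = t * (l * τ) := by
        refine smul_one_injective (Q := Q) ?_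
        linear_combination (norm := skip) - g₁ - g₂ - g₃ - g₄
        match_scalars <;> grind
      field_simp
      grind
    have all : ∀ x : F, SymbolRadical x := by
      intro x
      have h := ((hcon (1 + (t / τ * x) • e)).add (hcon 1)).add
        ((hcon ((t / τ * x) • e)).add (hcon 0))
      have k := key (t / τ * x)
      rw [show t / τ * x * τ / t = x by field_simp] at k
      convert h using 1
      grind
    exact all δ
  obtain ⟨d₁, d₂, d₃, f, hne, hsum⟩ := exists_value_three hγ hQ (hδ' d) h₂ h₃ hd
  refine ⟨d₁, d₂, d₃, d * d₁, f, by tauto, ?_⟩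
  rw [← hsum, γ.map_mul']
  simp only [mul_add, add_mul, mul_assoc]
  abel

/-- Elements of reduced trace one that generate an anisotropic three-dimensional form. -/
theorem exists_anisotropic_three (hγ : γ.IsCanonical) (hQ : SymbolRealizable F Q)
    (hdim : Module.finrank F Q = 4) :
    ∃ x₁ x₂ x₃ : Q, γ x₁ = x₁ + 1 ∧ γ x₂ = x₂ + 1 ∧ γ x₃ = x₃ + 1 ∧
      ∀ (d₁ d₂ d₃ : Q) (f : F),
        γ d₁ * x₁ * d₁ + γ d₂ * x₂ * d₂ + γ d₃ * x₃ * d₃ = f • 1 →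
          d₁ = 0 ∧ d₂ = 0 ∧ d₃ = 0 := by
  obtain ⟨a, c, i, j, P⟩ := exists_symbolPair hγ hdim
  -- The invariants `a`, `b`, `a + b` sum to zero, but the sum of any two is not radical. A relation
  -- with three nonzero terms would make zero nonradical; shorter ones contradict the pairwise
  -- condition or the nonzero traces.
  obtain ⟨b, hb, hab⟩ := exists_not_symbolRadical_add hγ hdim a
  have ha := not_symbolRadical_of_map hγ (P.map_left hγ) P.ii
  obtain ⟨x₂, m₂, s₂⟩ := hQ.exists_of_not_symbolRadical hγ hb
  obtain ⟨x₃, m₃, s₃⟩ := hQ.exists_of_not_symbolRadical hγ hab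
  have h₁ := IsArtinSchreier.of_one (P.map_left hγ) P.ii
  have h₂ := IsArtinSchreier.of_one m₂ s₂
  have h₃ := IsArtinSchreier.of_one m₃ s₃
  have hone : ∀ {x d : Q} {δ f : F}, IsArtinSchreier γ x 1 δ → γ d * x * d = f • 1 → d = 0 := by
    intro x d δ f h hd
    by_contra hd0
    obtain ⟨s, hs⟩ := h.conj hγ hd0
    have h1 := hs.map
    rw [hd, γ.map_smul_one, left_eq_add] at h1
    exact hs.ne (by simpa using h1)
  have htwo : ∀ {x y d e : Q} {δ ε f : F}, IsArtinSchreier γ x 1 δ → IsArtinSchreier γ y 1 ε →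
      ¬SymbolRadical (δ + ε) → γ d * x * d + γ e * y * e = f • 1 → d = 0 ∧ e = 0 := by
    intro x y d e δ ε f h h' hne hsum
    by_cases hd : d = 0
    · subst hd
      simp only [map_zero, zero_mul, zero_add] at hsum
      exact ⟨rfl, hone h' hsum⟩
    by_cases he : e = 0
    · subst he
      simp only [map_zero, zero_mul, add_zero] at hsum
      exact ⟨hone h hsum, rfl⟩
    obtain ⟨s, hs⟩ := h.conj hγ hd
    obtain ⟨s', hs'⟩ := h'.conj hγ he
    exact absurd (hs.symbolRadical_add hs' hsum) hne
  refine ⟨i, x₂, x₃, P.map_left hγ, m₂, m₃, fun d₁ d₂ d₃ f hsum => ?_⟩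
  by_cases e₁ : d₁ = 0
  · subst e₁
    simp only [map_zero, zero_mul, zero_add] at hsum
    exact ⟨rfl, htwo h₂ h₃ (by rwa [add_comm a, CharTwo.add_cancel_left]) hsum⟩
  by_cases e₂ : d₂ = 0
  · subst e₂
    simp only [map_zero, zero_mul, add_zero] at hsum
    have := htwo h₁ h₃ (by rwa [CharTwo.add_cancel_left]) hsum
    exact ⟨this.1, rfl, this.2⟩
  by_cases e₃ : d₃ = 0
  · subst e₃
    simp only [map_zero, zero_mul, add_zero] at hsum
    have := htwo h₁ h₂ hab hsum
    exact ⟨this.1, this.2, rfl⟩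
  obtain ⟨_, g₁⟩ := h₁.conj hγ e₁
  obtain ⟨_, g₂⟩ := h₂.conj hγ e₂
  obtain ⟨_, g₃⟩ := h₃.conj hγ e₃
  refine absurd (fun c _ => ⟨0, 0, ?_⟩) (g₁.not_symbolRadical_add_add hγ g₂ g₃ hsum)
  rw [CharTwo.add_self_eq_zero]
  ring

end Isotropy

/-! ### Comparison of involutions. -/

section SkolemNoether

variable {F : Type u} [Field F] [CharP F 2] {Q : Type v} [DivisionRing Q] [Algebra F Q]
  {γ : FInvolution F Q}

/-- Put `y = i x + x i`. Then `x + y` commutes with `i`, and `y (i + 1) = i y`, so `y j⁻¹` does too.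
-/
theorem IsSymbolPair.exists_eq_add_mul {a c : F} {i j : Q} (hγ : γ.IsCanonical)
    (P : IsSymbolPair a c i j) (x : Q) :
    ∃ p q r s : F, x = p • 1 + q • i + (r • 1 + s • i) * j := by
  have := charP_two_of_algebra F Q
  have h2 : (2 : F) = 0 := CharTwo.two_eq_zero
  have hy : (i * x + x * i) * (i + 1) = i * (i * x + x * i) := by
    simp only [mul_add, add_mul, mul_assoc, P.ii, P.ii_mul, mul_one, mul_smul_comm]
    match_scalars <;> grind
  obtain ⟨p, q, hpq⟩ := hγ.exists_smul_add_of_commute (P.map_left hγ)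
    (e := x + (i * x + x * i)) (by
      simp only [mul_add, add_mul, mul_assoc, P.ii, P.ii_mul, mul_one, mul_smul_comm]
      match_scalars <;> grind)
  obtain ⟨r, s, hrs⟩ := hγ.exists_smul_add_of_commute (P.map_left hγ)
    (e := (i * x + x * i) * j⁻¹) (by rw [mul_assoc, P.inv_mul, ← mul_assoc, hy, mul_assoc])
  refine ⟨p, q, r, s, ?_⟩
  rw [← hpq, ← hrs, inv_mul_cancel_right₀ P.ne, CharTwo.add_cancel_right]

/-- Every `F`-linear involution is the canonical one followed by an inner automorphism. -/
theorem FInvolution.exists_eq_conj [Algebra.IsCentral F Q] (hγ : γ.IsCanonical)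
    (hdim : Module.finrank F Q = 4) (θ : FInvolution F Q) :
    ∃ u : Q, u ≠ 0 ∧ γ u = u ∧ ∀ x, θ x * u = u * γ x := by
  have := charP_two_of_algebra F Q
  have h2 : (2 : F) = 0 := CharTwo.two_eq_zero
  obtain ⟨a, c, i, j, P⟩ := exists_symbolPair hγ hdim
  have hii : θ i * θ i = θ i + a • 1 := by
    rw [← θ.map_mul', P.ii, map_add, θ.map_smul_one]
  have hij : θ i * θ j = θ j * θ i + θ j := by
    rw [← θ.map_mul', P.ji, map_add, θ.map_mul']
  have hjj : θ j * θ j = c • 1 := by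
    rw [← θ.map_mul', P.jj, θ.map_smul_one]
  obtain ⟨g, hg, hgi⟩ := exists_conj_of_sq (x := i) (y := θ i + 1) (t := 1) (n := a)
    (by rw [P.ii, one_smul]) (by
      simp only [mul_add, add_mul, hii, mul_one, one_mul]
      match_scalars <;> grind) ⟨j, P.not_commute⟩
  obtain ⟨u, hu, hui, huj⟩ : ∃ u : Q, u ≠ 0 ∧ (θ i + 1) * u = u * i ∧ θ j * u = u * j := by
    by_cases hgj : θ j * g = g * j
    · exact ⟨g, hg, hgi, hgj⟩
    -- Up to the factor `c`, this averages `g` over the involutive map `m ↦ θ(j) m j⁻¹`, which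
    -- preserves the relation already found for `i`.
    refine ⟨θ j * g * j + c • g, fun h0 => hgj ?_, ?_, ?_⟩
    · apply mul_right_cancel₀ P.ne
      rw [CharTwo.add_eq_zero] at h0
      rw [h0, mul_assoc, P.jj, mul_smul_comm, mul_one]
    · have e : (θ i + 1) * (θ j * g * j) = θ j * g * j * i := by
        have e1 : (θ i + 1) * θ j = θ j * θ i := by
          rw [add_mul, hij, one_mul, CharTwo.add_cancel_right]
        have e2 : θ i * g = g * (i + 1) := by
          rw [mul_add, ← hgi, add_mul, one_mul, mul_one, CharTwo.add_cancel_right]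
        have e3 : (i + 1) * j = j * i := by rw [P.ji, add_mul, one_mul]
        rw [mul_assoc (θ j), ← mul_assoc, e1, mul_assoc, ← mul_assoc (θ i), e2, mul_assoc g, e3]
        simp only [mul_assoc]
      rw [mul_add (θ i + 1), e, mul_smul_comm, hgi, add_mul (θ j * g * j), smul_mul_assoc]
    · simp only [mul_add, add_mul, ← mul_assoc, hjj, mul_smul_comm, smul_mul_assoc, one_mul]
      rw [mul_assoc _ j j, P.jj, mul_smul_comm, mul_one, add_comm]
  have hθ : ∀ x, θ x * u = u * γ x := by
    have hi : θ i * u = u * γ i := by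
      rw [P.map_left hγ, mul_add, ← hui, add_mul, one_mul, mul_one, CharTwo.add_cancel_right]
    have hj : θ j * u = u * γ j := by rw [P.map_right hγ, huj]
    intro x
    obtain ⟨p, q, r, s, rfl⟩ := P.exists_eq_add_mul hγ x
    have he : ∀ p q : F, θ (p • 1 + q • i) * u = u * γ (p • 1 + q • i) := fun p q => by
      simp only [map_add, map_smul, θ.map_one, γ.map_one, mul_add, add_mul, smul_mul_assoc,
        mul_smul_comm, hi, one_mul, mul_one]
    generalize he₁ : p • (1 : Q) + q • i = e₁
    generalize he₂ : r • (1 : Q) + s • i = e₂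
    have h₁ := he p q
    have h₂ := he r s
    rw [he₁] at h₁
    rw [he₂] at h₂
    rw [map_add, map_add, add_mul, mul_add, h₁, θ.map_mul', γ.map_mul', mul_assoc, h₂, ← mul_assoc,
      hj, mul_assoc]
  refine ⟨u, hu, ?_, hθ⟩
  have hγu := γ.map_ne_zero hu
  -- Because `θ² = 1`, `u` and `γ(u)` differ by a scalar `l` with `l² = 1`; characteristic two
  -- leaves only `l = 1`.
  have hcen : u * (γ u)⁻¹ ∈ Subalgebra.center F Q := by
    rw [Subalgebra.mem_center_iff]
    intro x
    have e1 := hθ (θ x)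
    have e2 := congrArg γ (hθ x)
    rw [θ.invol'] at e1
    rw [γ.map_mul', γ.map_mul', γ.invol', ← eq_inv_mul_iff_mul_eq₀ hγu] at e2
    rw [← mul_assoc, e1, e2]
    simp only [mul_assoc, mul_inv_cancel₀ hγu, mul_one]
  rw [Algebra.IsCentral.center_eq_bot, Algebra.mem_bot] at hcen
  obtain ⟨l, hl⟩ := hcen
  rw [Algebra.algebraMap_eq_smul_one, eq_mul_inv_iff_mul_eq₀ hγu, smul_one_mul] at hl
  have hl' := congrArg γ hl
  rw [map_smul, γ.invol'] at hl'
  rw [← hl', smul_smul] at hl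
  have h1 : l * l = 1 := by
    have h0 : (l * l - 1) • u = 0 := by rw [sub_smul, hl, one_smul, sub_self]
    exact sub_eq_zero.1 ((smul_eq_zero.1 h0).resolve_right hu)
  have h1' : l = 1 := CharTwo.sq_injective (by simp [sq, h1])
  rw [← hl', h1', one_smul]

end SkolemNoether

/-! ### Orthogonal bases, scaling and diagonal forms. -/

section Forms

variable {F : Type u} [Field F] {D : Type v} [DivisionRing D] [Algebra F D]
  {θ θ' : FInvolution F D} {V : Type w} [AddCommGroup V] [Module Dᵐᵒᵖ V]

theorem FInvolution.mem_alt {a : D} : a ∈ θ.alt ↔ ∃ b, b - θ b = a := by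
  simp [FInvolution.alt, LinearMap.mem_range]

theorem FInvolution.map_inv_eq (θ : FInvolution F D) {u : D} (hu : u ≠ 0) (h : θ u = u) :
    θ u⁻¹ = u⁻¹ := by
  have e := θ.map_mul' u u⁻¹
  rw [mul_inv_cancel₀ hu, θ.map_one, h] at e
  exact eq_inv_of_mul_eq_one_left e.symm

theorem FInvolution.conj_mkQ (d a : D) : θ.conj d (θ.alt.mkQ a) = θ.alt.mkQ (θ d * (a * d)) := rfl

theorem FInvolution.mkQ_eq_zero {a : D} : θ.alt.mkQ a = 0 ↔ a ∈ θ.alt := by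
  rw [← LinearMap.mem_ker, Submodule.ker_mkQ]

namespace HermForm

theorem smul_right (h : HermForm θ V) (x y : V) (d : D) : h x (y <• d) = h x y * d := by
  simpa [θ.map_one] using h.smul' x y 1 d

/-- A hermitian form is linear in its second argument. -/
def rightLinear (h : HermForm θ V) (x : V) : V →ₗ[Dᵐᵒᵖ] D where
  toFun := h x
  map_add' := h.add_right' x
  map_smul' c y := h.smul_right x y c.unop

theorem map_sum_right (h : HermForm θ V) (x : V) {ι : Type*} (s : Finset ι) (f : ι → V) :
    h x (∑ i ∈ s, f i) = ∑ i ∈ s, h x (f i) := map_sum (h.rightLinear x) f s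

theorem map_zero_right (h : HermForm θ V) (x : V) : h x 0 = 0 := map_zero (h.rightLinear x)

theorem map_sub_right (h : HermForm θ V) (x y z : V) : h x (y - z) = h x y - h x z :=
  map_sub (h.rightLinear x) y z

theorem eq_zero_comm (h : HermForm θ V) {x y : V} (hxy : h x y = 0) : h y x = 0 := by
  rw [h.symm', hxy, map_zero]

/-- If `h x y ≠ 0`, rescaling `y` makes it equal to `b`, and then `h (x + y) (x + y) = b + θ b ≠ 0`.
-/
theorem eq_zero_of_alternating (h : HermForm θ V) (hθ : ∃ b : D, b + θ b ≠ 0)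
    (U : Submodule Dᵐᵒᵖ V) (hU : ∀ x ∈ U, h x x = 0) {x y : V} (hx : x ∈ U) (hy : y ∈ U) :
    h x y = 0 := by
  by_contra hxy
  obtain ⟨b, hb⟩ := hθ
  have hy' : y <• ((h x y)⁻¹ * b) ∈ U := U.smul_mem _ hy
  have e := hU _ (U.add_mem hx hy')
  rw [h.add_left', h.add_right', h.add_right', hU _ hx, hU _ hy', zero_add, add_zero,
    h.symm' x (y <• _), h.smul_right, mul_inv_cancel_left₀ hxy] at e
  exact hb e

/-- A nondegenerate form over an involution that is not `-1` has an orthogonal basis. -/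
theorem Nondegenerate.exists_orthogonal [Module.Finite Dᵐᵒᵖ V] {h : HermForm θ V}
    (hnd : h.Nondegenerate) (hθ : ∃ b : D, b + θ b ≠ 0) (k : ℕ)
    (hk : k ≤ Module.finrank Dᵐᵒᵖ V) :
    ∃ v : Fin k → V, (∀ i, h (v i) (v i) ≠ 0) ∧ ∀ i j, i ≠ j → h (v i) (v j) = 0 := by
  induction k with
  | zero => exact ⟨Fin.elim0, fun i => i.elim0, fun i => i.elim0⟩
  | succ k ih =>
    obtain ⟨v, hv, hvo⟩ := ih (Nat.le_of_succ_le hk)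
    let U : Submodule Dᵐᵒᵖ V := ⨅ i, LinearMap.ker (h.rightLinear (v i))
    have memU : ∀ x, x ∈ U ↔ ∀ i, h (v i) x = 0 := fun x => by
      simp only [U, Submodule.mem_iInf, LinearMap.mem_ker]
      rfl
    have proj : ∀ x, x - ∑ i, v i <• ((h (v i) (v i))⁻¹ * h (v i) x) ∈ U := fun x => by
      rw [memU]
      intro i
      rw [h.map_sub_right, h.map_sum_right, Finset.sum_eq_single i]
      · rw [h.smul_right, mul_inv_cancel_left₀ (hv i), sub_self]
      · intro j _ hj
        rw [h.smul_right, hvo i j hj.symm, zero_mul]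
      · simp
    -- Otherwise `h` vanishes on the orthogonal complement `U`, which then lies in the radical of
    -- `h`; so the `k` vectors already span `V`.
    obtain ⟨u, hu, hu0⟩ : ∃ u ∈ U, h u u ≠ 0 := by
      by_contra! hcon
      have hspan : ∀ x, x - ∑ i, v i <• ((h (v i) (v i))⁻¹ * h (v i) x) = 0 := fun x => by
        refine hnd _ fun y => ?_
        rw [← sub_add_cancel y (∑ i, v i <• ((h (v i) (v i))⁻¹ * h (v i) y)), h.add_right',
          h.eq_zero_of_alternating hθ U hcon (proj x) (proj y), zero_add, h.map_sum_right]
        refine Finset.sum_eq_zero fun i _ => ?_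
        rw [h.smul_right, h.eq_zero_comm ((memU _).1 (proj x) i), zero_mul]
      have htop : Submodule.span Dᵐᵒᵖ (Set.range v) = ⊤ := by
        rw [eq_top_iff]
        intro x _
        rw [sub_eq_zero.1 (hspan x)]
        exact Submodule.sum_mem _ fun i _ =>
          Submodule.smul_mem _ _ (Submodule.subset_span ⟨i, rfl⟩)
      have := finrank_range_le_card (R := Dᵐᵒᵖ) v
      rw [Set.finrank, htop, finrank_top, Fintype.card_fin] at this
      omega
    rw [memU] at hu
    refine ⟨Fin.cons u v, ?_, ?_⟩
    · intro i
      cases i using Fin.cases with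
      | zero => exact hu0
      | succ i => exact hv i
    · intro i j hij
      cases i using Fin.cases with
      | zero =>
        cases j using Fin.cases with
        | zero => exact absurd rfl hij
        | succ j => exact h.eq_zero_comm (hu j)
      | succ i =>
        cases j using Fin.cases with
        | zero => exact hu i
        | succ j => exact hvo i j fun e => hij (e ▸ rfl)

theorem sum_ne_zero (h : HermForm θ V) {k : ℕ} {v : Fin k → V} (hv : ∀ i, h (v i) (v i) ≠ 0)
    (hvo : ∀ i j, i ≠ j → h (v i) (v j) = 0) {d : Fin k → D} {i : Fin k} (hi : d i ≠ 0) :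
    ∑ i, v i <• d i ≠ 0 := by
  intro h0
  have e : h (v i) (∑ i, v i <• d i) = h (v i) (v i) * d i := by
    rw [h.map_sum_right, Finset.sum_eq_single i]
    · rw [h.smul_right]
    · intro j _ hj
      rw [h.smul_right, hvo i j hj.symm, zero_mul]
    · simp
  rw [h0, h.map_zero_right] at e
  exact mul_ne_zero (hv i) hi e.symm

/-- Multiplication of a hermitian form from the left with an element that conjugates its involution
into another one. -/
def scale (f : HermForm θ V) (u : D) (hu : u ≠ 0) (hθu : θ u = u)
    (h : ∀ x, θ' x * u = u * θ x) : HermForm θ' V where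
  toFun x y := u * f x y
  add_left' x y z := by rw [f.add_left', mul_add]
  add_right' x y z := by rw [f.add_right', mul_add]
  smul' x y c d := by
    rw [f.smul']
    simp only [← mul_assoc, h]
  symm' x y := by
    have hθ'u : θ' u = u := mul_right_cancel₀ hu (by rw [h, hθu])
    rw [θ'.map_mul', hθ'u, h, ← f.symm']

/-- The polar form of a diagonal quadratic form. -/
def diagonal (θ : FInvolution F D) {k : ℕ} (a : Fin k → D) : HermForm θ (Fin k → D) where
  toFun x y := ∑ i, θ (x i) * ((a i + θ (a i)) * y i)
  add_left' x y z := by simp only [Pi.add_apply, map_add, add_mul, Finset.sum_add_distrib]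
  add_right' x y z := by simp only [Pi.add_apply, mul_add, Finset.sum_add_distrib]
  smul' x y c d := by
    simp only [Finset.sum_mul, Finset.mul_sum, Pi.smul_apply, MulOpposite.smul_eq_mul_unop,
      MulOpposite.unop_op, θ.map_mul', mul_assoc]
  symm' x y := by
    simp only [map_sum, θ.map_mul', θ.invol', map_add, mul_assoc, add_comm (a _)]

end HermForm

namespace QuadForm

theorem map_zero (q : QuadForm θ V) : q 0 = 0 := by
  have := q.smul' 0 0
  rw [smul_zero] at this
  rw [this]
  obtain ⟨a, ha⟩ := θ.alt.mkQ_surjective (q 0)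
  rw [← ha, θ.conj_mkQ]
  simp

theorem map_add_of_polar_eq_zero (q : QuadForm θ V) {x y : V} (h : q.polar x y = 0) :
    q (x + y) = q x + q y := by
  have := q.polar_spec x y
  rw [h, _root_.map_zero, sub_sub, sub_eq_zero] at this
  exact this

theorem map_sum_of_orthogonal (q : QuadForm θ V) {ι : Type*} [DecidableEq ι] (s : Finset ι)
    (v : ι → V) (hv : ∀ i j, i ≠ j → q.polar (v i) (v j) = 0) (d : ι → D) :
    q (∑ i ∈ s, v i <• d i) = ∑ i ∈ s, θ.conj (d i) (q (v i)) := by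
  induction s using Finset.induction_on with
  | empty => exact q.map_zero
  | insert i s hi ih =>
    rw [Finset.sum_insert hi, Finset.sum_insert hi, q.map_add_of_polar_eq_zero, ih, q.smul']
    rw [q.polar.map_sum_right]
    refine Finset.sum_eq_zero fun j hj => ?_
    rw [q.polar.smul', hv i j (by rintro rfl; exact hi hj), mul_zero, zero_mul]

/-- Expanding `q` at `x (1 + d)` puts every right multiple of `h(x, x) - (a + θ a)` in `Alt`. A
nonzero difference would make `Alt` everything. -/
theorem polar_self (q : QuadForm θ V) (hθ : θ.alt ≠ ⊤) {x : V} {a : D}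
    (ha : q x = θ.alt.mkQ a) : q.polar x x = a + θ a := by
  have key : ∀ d, (q.polar x x - (a + θ a)) * d ∈ θ.alt := fun d => by
    have h := q.polar_spec x (x <• d)
    have e : x + x <• d = x <• (1 + d) := by
      rw [MulOpposite.op_add, add_smul, MulOpposite.op_one, one_smul]
    rw [e, q.smul', q.smul', ha, θ.conj_mkQ, θ.conj_mkQ, ← map_sub, ← map_sub, q.polar.smul_right,
      ← sub_eq_zero, ← map_sub, θ.mkQ_eq_zero, θ.mem_alt] at h
    obtain ⟨b, hb⟩ := h
    rw [θ.mem_alt]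
    refine ⟨θ d * a - b, ?_⟩
    rw [map_sub, sub_sub_sub_comm, hb, θ.map_mul', θ.invol', map_add, θ.map_one]
    noncomm_ring
  by_contra hne
  apply hθ
  rw [eq_top_iff]
  intro y _
  have := key ((q.polar x x - (a + θ a))⁻¹ * y)
  rwa [mul_inv_cancel_left₀ (sub_ne_zero.2 hne)] at this

/-- Multiplication of a quadratic form from the left with an element that conjugates its involution
into another one. -/
def scale (q : QuadForm θ V) (u : D) (hu : u ≠ 0) (hθu : θ u = u)
    (h : ∀ x, θ' x * u = u * θ x) : QuadForm θ' V where
  toFun x := θ.alt.mapQ θ'.alt (LinearMap.mulLeft F u) (by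
    intro a ha
    rw [Submodule.mem_comap, θ'.mem_alt]
    obtain ⟨b, rfl⟩ := θ.mem_alt.1 ha
    have hθ'u : θ' u = u := mul_right_cancel₀ hu (by rw [h, hθu])
    exact ⟨u * b, by rw [θ'.map_mul', hθ'u, h, LinearMap.mulLeft_apply, mul_sub]⟩) (q x)
  smul' x d := by
    obtain ⟨a, ha⟩ := θ.alt.mkQ_surjective (q x)
    rw [q.smul', ← ha, θ.conj_mkQ]
    refine congrArg θ'.alt.mkQ (?_ : u * (θ d * (a * d)) = θ' d * (u * a * d))
    simp only [← mul_assoc, h]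
  exists_polar' := by
    refine ⟨q.polar.scale u hu hθu h, fun x y => ?_⟩
    rw [← map_sub, ← map_sub, q.polar_spec]
    rfl

theorem scale_polar (q : QuadForm θ V) (u : D) (hu : u ≠ 0) (hθu : θ u = u)
    (h : ∀ x, θ' x * u = u * θ x) (x y : V) :
    (q.scale u hu hθu h).polar x y = u * q.polar x y := by
  refine ((q.scale u hu hθu h).polar_unique (q.polar.scale u hu hθu h) (fun x y => ?_) x y).symm
  simp only [scale]
  rw [← map_sub, ← map_sub, q.polar_spec]
  rfl

theorem Nonsingular.scale {q : QuadForm θ V} (hq : q.Nonsingular) (u : D) (hu : u ≠ 0)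
    (hθu : θ u = u) (h : ∀ x, θ' x * u = u * θ x) : (q.scale u hu hθu h).Nonsingular :=
  fun x hx => hq x fun y => by
    have := hx y
    rw [scale_polar] at this
    exact (mul_eq_zero.1 this).resolve_left hu

theorem Isotropic.of_scale {q : QuadForm θ V} (u : D) (hu : u ≠ 0) (hθu : θ u = u)
    (h : ∀ x, θ' x * u = u * θ x) (hq : (q.scale u hu hθu h).Isotropic) : q.Isotropic := by
  obtain ⟨x, hx0, hx⟩ := hq
  refine ⟨x, hx0, ?_⟩
  obtain ⟨a, ha⟩ := θ.alt.mkQ_surjective (q x)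
  have e : (q.scale u hu hθu h) x = θ'.alt.mkQ (u * a) := by
    simp only [QuadForm.scale, ← ha]
    rfl
  rw [e, θ'.mkQ_eq_zero, θ'.mem_alt] at hx
  obtain ⟨b, hb⟩ := hx
  have hinv := θ.map_inv_eq hu hθu
  have hb' : θ b * u⁻¹ = u⁻¹ * θ' b := by
    rw [eq_inv_mul_iff_mul_eq₀ hu, ← mul_assoc, ← h, mul_inv_cancel_right₀ hu]
  rw [← ha, θ.mkQ_eq_zero, θ.mem_alt]
  refine ⟨u⁻¹ * b, ?_⟩
  rw [θ.map_mul', hinv, hb', ← mul_sub, hb, inv_mul_cancel_left₀ hu]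

theorem diagonal_add_sub {k : ℕ} (a : Fin k → D) (x y : Fin k → D) :
    θ.alt.mkQ (∑ i, θ ((x + y) i) * (a i * (x + y) i)) - θ.alt.mkQ (∑ i, θ (x i) * (a i * x i)) -
      θ.alt.mkQ (∑ i, θ (y i) * (a i * y i)) = θ.alt.mkQ (HermForm.diagonal θ a x y) := by
  rw [← map_sub, ← map_sub, ← sub_eq_zero, ← map_sub, θ.mkQ_eq_zero]
  simp only [HermForm.diagonal]
  rw [← Finset.sum_sub_distrib, ← Finset.sum_sub_distrib, ← Finset.sum_sub_distrib]
  refine Submodule.sum_mem _ fun i _ => θ.mem_alt.2 ⟨θ (y i) * (a i * x i), ?_⟩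
  simp only [Pi.add_apply, map_add, θ.map_mul', θ.invol']
  noncomm_ring

/-- The diagonal quadratic form with given coefficients. -/
def diagonal (θ : FInvolution F D) {k : ℕ} (a : Fin k → D) : QuadForm θ (Fin k → D) where
  toFun x := θ.alt.mkQ (∑ i, θ (x i) * (a i * x i))
  smul' x d := by
    rw [θ.conj_mkQ]
    refine congrArg θ.alt.mkQ ?_
    simp only [Finset.sum_mul, Finset.mul_sum, Pi.smul_apply, MulOpposite.smul_eq_mul_unop,
      MulOpposite.unop_op, θ.map_mul', mul_assoc]
  exists_polar' := ⟨HermForm.diagonal θ a, diagonal_add_sub a⟩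

theorem diagonal_polar (θ : FInvolution F D) {k : ℕ} (a : Fin k → D) (x y : Fin k → D) :
    (diagonal θ a).polar x y = ∑ i, θ (x i) * ((a i + θ (a i)) * y i) := by
  refine ((diagonal θ a).polar_unique (HermForm.diagonal θ a) (fun x y => ?_) x y).symm
  exact diagonal_add_sub a x y

theorem diagonal_nonsingular (θ : FInvolution F D) {k : ℕ} {a : Fin k → D}
    (ha : ∀ i, a i + θ (a i) ≠ 0) : (diagonal θ a).Nonsingular := by
  intro x hx
  funext i
  have h := hx (Pi.single i 1)
  rw [diagonal_polar, Finset.sum_eq_single i] at h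
  · rw [Pi.single_eq_same, mul_one] at h
    by_contra h0
    exact mul_ne_zero (θ.map_ne_zero h0) (ha i) h
  · intro j _ hj
    rw [Pi.single_eq_of_ne hj, mul_zero, mul_zero]
  · simp

end QuadForm

end Forms

/-! ### Isotropy and anisotropy over the canonical involution. -/

section CanonicalForms

variable {F : Type u} [Field F] [CharP F 2] {Q : Type v} [DivisionRing Q] [Algebra F Q]
  [Algebra.IsCentral F Q] {γ : FInvolution F Q}

theorem FInvolution.IsCanonical.mem_alt_iff (hγ : γ.IsCanonical) (hdim : Module.finrank F Q = 4)
    {x : Q} : x ∈ γ.alt ↔ ∃ r : F, x = r • 1 := by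
  have := charP_two_of_algebra F Q
  rw [γ.mem_alt]
  constructor
  · rintro ⟨b, rfl⟩
    obtain ⟨t, n, ht, -, -⟩ := hγ.exists_trace_norm b
    exact ⟨t, by rw [ht, CharTwo.sub_eq_add, CharTwo.add_cancel_left]⟩
  · rintro ⟨r, rfl⟩
    obtain ⟨a, c, i, j, P⟩ := exists_symbolPair hγ hdim
    refine ⟨r • i, ?_⟩
    rw [map_smul, P.map_left hγ, ← smul_sub, CharTwo.sub_eq_add, CharTwo.add_cancel_left]

theorem FInvolution.IsCanonical.alt_ne_top (hγ : γ.IsCanonical) (hdim : Module.finrank F Q = 4) :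
    γ.alt ≠ ⊤ := by
  obtain ⟨a, c, i, j, P⟩ := exists_symbolPair hγ hdim
  intro h
  obtain ⟨r, hr⟩ := (hγ.mem_alt_iff hdim).1 (h ▸ Submodule.mem_top : i ∈ γ.alt)
  exact ne_smul_one_of_not_commute P.not_commute r hr

theorem FInvolution.IsCanonical.exists_add_ne_zero (hγ : γ.IsCanonical)
    (hdim : Module.finrank F Q = 4) : ∃ b : Q, b + γ b ≠ 0 := by
  have := charP_two_of_algebra F Q
  obtain ⟨a, c, i, j, P⟩ := exists_symbolPair hγ hdim
  exact ⟨i, by rw [P.map_left hγ, CharTwo.add_cancel_left]; exact one_ne_zero⟩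

namespace QuadForm

variable {V : Type w} [AddCommGroup V] [Module Qᵐᵒᵖ V]

theorem ne_of_polar_self_ne_zero (hγ : γ.IsCanonical) (hdim : Module.finrank F Q = 4)
    {q : QuadForm γ V} {x : V} {a : Q} (ha : q x = γ.alt.mkQ a) (h : q.polar x x ≠ 0) :
    γ a ≠ a := by
  have := charP_two_of_algebra F Q
  rw [q.polar_self (hγ.alt_ne_top hdim) ha] at h
  intro h'
  rw [h', CharTwo.add_self_eq_zero] at h
  exact h rfl

theorem Nonsingular.isotropic_of_four_le [Module.Finite Qᵐᵒᵖ V] (hγ : γ.IsCanonical)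
    (hQ : SymbolRealizable F Q) (hdim : Module.finrank F Q = 4) {q : QuadForm γ V}
    (hq : q.Nonsingular) (h4 : 4 ≤ Module.finrank Qᵐᵒᵖ V) : q.Isotropic := by
  obtain ⟨v, hv, hvo⟩ := HermForm.Nondegenerate.exists_orthogonal hq
    (hγ.exists_add_ne_zero hdim) 4 h4
  choose a ha using fun i => γ.alt.mkQ_surjective (q (v i))
  have hne : ∀ i, γ (a i) ≠ a i := fun i =>
    ne_of_polar_self_ne_zero hγ hdim (ha i).symm (hv i)
  obtain ⟨d₁, d₂, d₃, d₄, f, hd, hsum⟩ :=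
    exists_value_four hγ hQ hdim (hne 0) (hne 1) (hne 2) (hne 3)
  set d : Fin 4 → Q := ![d₁, d₂, d₃, d₄] with hd_def
  refine ⟨∑ i, v i <• d i, ?_, ?_⟩
  · obtain ⟨i, hi⟩ : ∃ i, d i ≠ 0 := by
      by_contra! hcon
      exact hd ⟨hcon 0, hcon 1, hcon 2, hcon 3⟩
    exact q.polar.sum_ne_zero hv hvo hi
  · rw [q.map_sum_of_orthogonal _ _ hvo]
    simp only [← ha, γ.conj_mkQ]
    rw [← map_sum, γ.mkQ_eq_zero, hγ.mem_alt_iff hdim]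
    refine ⟨f, ?_⟩
    rw [← hsum, Fin.sum_univ_four]
    simp [hd_def, mul_assoc]

theorem isotropic_orthSum_of_three_one {V₁ V₂ : Type w} [AddCommGroup V₁] [AddCommGroup V₂]
    [Module Qᵐᵒᵖ V₁] [Module Qᵐᵒᵖ V₂] [Module.Finite Qᵐᵒᵖ V₁] (hγ : γ.IsCanonical)
    (hQ : SymbolRealizable F Q) (hdim : Module.finrank F Q = 4) {q₁ : QuadForm γ V₁}
    {q₂ : QuadForm γ V₂} (h₁ : q₁.Nonsingular) (h3 : 3 ≤ Module.finrank Qᵐᵒᵖ V₁)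
    (h₂ : q₂.TotallySingular) (hV₂ : Nontrivial V₂) : (q₁.orthSum q₂).Isotropic := by
  have := charP_two_of_algebra F Q
  obtain ⟨w, hw⟩ := exists_ne (0 : V₂)
  obtain ⟨v, hv, hvo⟩ := HermForm.Nondegenerate.exists_orthogonal h₁
    (hγ.exists_add_ne_zero hdim) 3 h3
  choose a ha using fun i => γ.alt.mkQ_surjective (q₁ (v i))
  have hne : ∀ i, γ (a i) ≠ a i := fun i =>
    ne_of_polar_self_ne_zero hγ hdim (ha i).symm (hv i)
  obtain ⟨z, hz⟩ := γ.alt.mkQ_surjective (q₂ w)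
  have hzγ : γ z = z := by
    have h := q₂.polar_self (hγ.alt_ne_top hdim) hz.symm
    rw [h₂, eq_comm, CharTwo.add_eq_zero] at h
    exact h.symm
  obtain ⟨d₁, d₂, d₃, e, f, hd, hsum⟩ :=
    exists_value_three_one hγ hQ (hne 0) (hne 1) (hne 2) hzγ
  set d : Fin 3 → Q := ![d₁, d₂, d₃] with hd_def
  refine ⟨(∑ i, v i <• d i, w <• e), ?_, ?_⟩
  · intro h0
    rw [Prod.mk_eq_zero] at h0
    have hdi : ∀ i, d i = 0 := fun i => by
      by_contra hi
      exact q₁.polar.sum_ne_zero hv hvo hi h0.1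
    have he : e = 0 := by
      have := (smul_eq_zero.1 h0.2).resolve_right hw
      simpa using this
    exact hd ⟨hdi 0, hdi 1, hdi 2, he⟩
  · change q₁ (∑ i, v i <• d i) + q₂ (w <• e) = 0
    rw [q₁.map_sum_of_orthogonal _ _ hvo, q₂.smul']
    simp only [← ha, ← hz, γ.conj_mkQ]
    rw [← map_sum, ← map_add, γ.mkQ_eq_zero, hγ.mem_alt_iff hdim]
    refine ⟨f, ?_⟩
    rw [← hsum, Fin.sum_univ_three]
    simp [hd_def, mul_assoc]

theorem isotropic_of_hasType (hγ : γ.IsCanonical) (hQ : SymbolRealizable F Q)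
    (hdim : Module.finrank F Q = 4) {q : QuadForm γ V} (h : q.HasType 4 0 ∨ q.HasType 3 1) :
    q.Isotropic := by
  rcases h with h | h <;>
    obtain ⟨V₁, V₂, _, _, _, _, _, _, q₁, q₂, h₁, hd₁, h₂, hd₂, e, he⟩ := h
  · obtain ⟨x, hx, hqx⟩ := h₁.isotropic_of_four_le hγ hQ hdim hd₁.ge
    refine ⟨e.symm (x, 0), by simpa using hx, ?_⟩
    rw [he, e.apply_symm_apply]
    change q₁ x + q₂ 0 = 0
    rw [hqx, q₂.map_zero, add_zero]
  · have : Nontrivial V₂ := Module.nontrivial_of_finrank_pos (R := Qᵐᵒᵖ) (by omega)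
    obtain ⟨x, hx, hqx⟩ := isotropic_orthSum_of_three_one hγ hQ hdim h₁ hd₁.ge h₂ this
    exact ⟨e.symm x, by simpa using hx, by rw [he, e.apply_symm_apply, hqx]⟩

theorem exists_nonsingular_anisotropic_three (hγ : γ.IsCanonical) (hQ : SymbolRealizable F Q)
    (hdim : Module.finrank F Q = 4) :
    ∃ q : QuadForm γ (Fin 3 → Q), q.Nonsingular ∧ ¬q.Isotropic := by
  have := charP_two_of_algebra F Q
  obtain ⟨x₁, x₂, x₃, h₁, h₂, h₃, h⟩ := exists_anisotropic_three hγ hQ hdim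
  refine ⟨diagonal γ ![x₁, x₂, x₃], diagonal_nonsingular γ fun i => ?_, ?_⟩
  · fin_cases i <;> simp [h₁, h₂, h₃, CharTwo.add_cancel_left]
  · rintro ⟨y, hy0, hy⟩
    change γ.alt.mkQ _ = 0 at hy
    rw [γ.mkQ_eq_zero, hγ.mem_alt_iff hdim, Fin.sum_univ_three] at hy
    obtain ⟨f, hf⟩ := hy
    obtain ⟨e₁, e₂, e₃⟩ := h (y 0) (y 1) (y 2) f (by simpa [mul_assoc] using hf)
    apply hy0
    funext i
    fin_cases i <;> assumption

end QuadForm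

end CanonicalForms

/-! ### The invariant for all involutions. -/

theorem finrank_mulOpposite_pi (D : Type v) [DivisionRing D] (k : ℕ) :
    Module.finrank Dᵐᵒᵖ (Fin k → D) = k := by
  have h1 : Module.finrank Dᵐᵒᵖ D = 1 :=
    finrank_eq_one (1 : D) one_ne_zero fun w => ⟨MulOpposite.op w, by simp⟩
  have : Module.Finite Dᵐᵒᵖ D := Module.finite_of_finrank_pos (by omega)
  rw [Module.finrank_pi_fintype]
  simp [h1]

theorem mainTheorem9 {F : Type u} [Field F] [CharP F 2] (hF : IsKaplanskyField F)
    {Q : Type v} [DivisionRing Q] [Algebra F Q] (hQ : IsQuaternionAlgebra F Q)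
    (γ : FInvolution F Q) (hγ : γ.IsCanonical) :
    (∀ (V : Type w) [AddCommGroup V] [Module Qᵐᵒᵖ V] [Module.Finite Qᵐᵒᵖ V] (ρ : QuadForm γ V),
      ρ.HasType 4 0 ∨ ρ.HasType 3 1 → ρ.Isotropic) ∧
    ∀ θ : FInvolution F Q, uTilde θ = 3 := by
  have := hQ.central
  have hdim := hQ.finrank_eq
  have hreal : SymbolRealizable F Q := fun a c hc h => hF.exists_symbolPair hQ hc h
  refine ⟨fun V _ _ _ ρ h => QuadForm.isotropic_of_hasType hγ hreal hdim h, fun θ => ?_⟩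
  obtain ⟨u, hu, hγu, h⟩ := FInvolution.exists_eq_conj hγ hdim θ
  have hθu : θ u = u := mul_right_cancel₀ hu (by rw [h, hγu])
  apply le_antisymm
  · refine sSup_le ?_
    rintro n ⟨V, _, _, _, q, hq, hiso, rfl⟩
    by_contra! hlt
    have h4 : 4 ≤ Module.finrank Qᵐᵒᵖ V := by exact_mod_cast Order.add_one_le_of_lt hlt
    -- Scaling by `u⁻¹` carries forms over `θ` to forms over `γ`; scaling by `u` goes back and gives
    -- the lower bound.
    have h' : ∀ x, γ x * u⁻¹ = u⁻¹ * θ x := fun x => by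
      rw [eq_inv_mul_iff_mul_eq₀ hu, ← mul_assoc, ← h, mul_inv_cancel_right₀ hu]
    have hinv := θ.map_inv_eq hu hθu
    exact hiso (QuadForm.Isotropic.of_scale u⁻¹ (inv_ne_zero hu) hinv h'
      ((hq.scale u⁻¹ (inv_ne_zero hu) hinv h').isotropic_of_four_le hγ hreal hdim h4))
  · obtain ⟨q, hq, hiso⟩ := QuadForm.exists_nonsingular_anisotropic_three hγ hreal hdim
    have hfin := finrank_mulOpposite_pi Q 3
    exact le_sSup ⟨Fin 3 → Q, inferInstance, inferInstance,
      Module.finite_of_finrank_pos (by omega), q.scale u hu hγu h, hq.scale u hu hγu h,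
      fun hi => hiso (hi.of_scale u hu hγu h), by rw [hfin]; rfl⟩
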